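/- Let $M$ be a closed (compact, without boundary) connected smooth manifold, endowed with a smooth Riemannian metric with norms $|\cdot|_x$ on $T_xM$. Let $L\in C^\infty(TM)$ be a Tonelli Lagrangian, that is, $d_{vv}L(x,v)>0$ (the fibrewise second differential is positive definite) for every $(x,v)\in TM$, and $L(x,v)/|v|_x\to+\infty$ as $|v|_x\to+\infty$ for every $x\in M$. Assume moreover that $L$ is electromagnetic for $|v|$ large: there are a smooth Riemannian metric $h$, a smooth one-form $\theta$ and a smooth function $V$ on $M$, and a number $R$, such that $$L(x,v)=\tfrac12 h_x(v,v)+\theta(x)[v]-V(x)\qquad\text{whenever } |v|_x\ge R .$$ Let $\mathbb T=\mathbb R/\mathbb Z$, let $W^{1,2}(\mathbb T,M)$ be the Hilbert manifold of absolutely continuous loops $x:\mathbb T\to M$ with $\int_{\mathbb T}|x'(s)|^2_{x(s)}\,ds<\infty$ (its topology is the one induced from $W^{1,2}(\mathbb T,\mathbb R^N)$ by any smooth embedding $M\hookrightarrow\mathbb R^N$), and let $\mathcal M=W^{1,2}(\mathbb T,M)\times(0,+\infty)$. For $\kappa\in\mathbb R$ consider the free period action functional $$\mathbb S_\kappa:\mathcal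 M\to\mathbb R,\qquad \mathbb S_\kappa(x,T)=T\int_{\mathbb T}\Bigl(L\bigl(x(s),x'(s)/T\bigr)+\kappa\Bigr)\,ds ,$$ and let $$c_u(L)=\inf\bigl\{\kappa\in\mathbb R \;\big|\; \mathbb S_\kappa(x,T)\ge 0 \text{ for all } (x,T)\in\mathcal M \text{ with } x \text{ contractible}\bigr\}$$ be the lowest Mañé critical value. If $\kappa\ge c_u(L)$, then $\mathbb S_\kappa$ is bounded from below on every connected component of $\mathcal M$. If $\kappa<c_u(L)$, then $\mathbb S_\kappa$ is unbounded from below on every connected component of $\mathcal M$. -/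

import Mathlib

open Set Filter Topology MeasureTheory Bundle
open scoped Manifold ContDiff ENNReal

noncomputable section

namespace FreePeriod

/-! ### Tonelli Lagrangians on a Riemannian manifold `M` modelled on `E` -/

section Lagrangian

variable {E : Type*} [NormedAddCommGroup E] [NormedSpace ℝ E]
  {M : Type*} [TopologicalSpace M] [ChartedSpace E M] [IsManifold 𝓘(ℝ, E) ∞ M]
  [RiemannianBundle (fun x : M => TangentSpace 𝓘(ℝ, E) x)]

/-- A Tonelli Lagrangian: a smooth function on the tangent bundle whose fibrewise second
differential is positive definite everywhere and which has superlinear growth on each fibre. -/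
structure IsTonelli (L : TangentBundle 𝓘(ℝ, E) M → ℝ) : Prop where
  smooth : ContMDiff 𝓘(ℝ, E).tangent 𝓘(ℝ, ℝ) ∞ L
  convex : ∀ (x : M) (v u : TangentSpace 𝓘(ℝ, E) x), u ≠ 0 →
    0 < iteratedFDeriv ℝ 2 (fun w : TangentSpace 𝓘(ℝ, E) x => L ⟨x, w⟩) v ![u, u]
  superlinear : ∀ x : M,
    Tendsto (fun v : TangentSpace 𝓘(ℝ, E) x => L ⟨x, v⟩ / ‖v‖)
      (Bornology.cobounded (TangentSpace 𝓘(ℝ, E) x)) atTop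

/-- `L(x, v) = |v|² / 2 + θ(x)[v] - V(x)` for all `(x, v)` with `|v|` large, where the kinetic term
comes from some smooth Riemannian metric `h` (possibly different from the one fixed on `M`), `θ` is
a smooth one-form and `V` is a smooth function. -/
def IsElectromagneticAtInfinity (L : TangentBundle 𝓘(ℝ, E) M → ℝ) : Prop :=
  ∃ (h : ContMDiffRiemannianMetric 𝓘(ℝ, E) ∞ E (fun x : M => TangentSpace 𝓘(ℝ, E) x))
    (θ : Cₛ^∞⟮𝓘(ℝ, E); E →L[ℝ] ℝ,
      fun x : M => TangentSpace 𝓘(ℝ, E) x →L[ℝ] Bundle.Trivial M ℝ x⟯)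
    (V : C^∞⟮𝓘(ℝ, E), M; ℝ⟯) (R : ℝ),
    ∀ (x : M) (v : TangentSpace 𝓘(ℝ, E) x), R ≤ ‖v‖ →
      L ⟨x, v⟩ = (1 / 2 : ℝ) * h.inner x v v + (θ x v : ℝ) - V x

end Lagrangian

/-! ### The space of `W^{1,2}` loops -/

section Loops

variable (E : Type*) [NormedAddCommGroup E] [NormedSpace ℝ E]
  {M : Type*} [MetricSpace M] [ChartedSpace E M]

/-- The velocity `x'(s)`, a tangent vector of `M` at `x(s)`, of a loop `x : ℝ/ℤ → M`.  For an
absolutely continuous loop the derivative exists for almost every `s`. -/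
def velocity (x : C(UnitAddCircle, M)) (s : ℝ) : TangentSpace 𝓘(ℝ, E) (x (s : UnitAddCircle)) :=
  mfderiv 𝓘(ℝ, ℝ) 𝓘(ℝ, E) (fun r : ℝ => x (r : UnitAddCircle)) s (1 : ℝ)

variable [RiemannianBundle (fun x : M => TangentSpace 𝓘(ℝ, E) x)]

/-- `x` is absolutely continuous and `∫ |x'(s)|² ds < ∞`. -/
def IsSobolevLoop (x : C(UnitAddCircle, M)) : Prop :=
  AbsolutelyContinuousOnInterval (fun s : ℝ => x (s : UnitAddCircle)) 0 1 ∧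
    ∫⁻ s in Ioc (0 : ℝ) 1, ‖velocity E x s‖ₑ ^ 2 < ⊤

variable (M)

/-- The loop space `W^{1,2}(ℝ/ℤ, M)`. -/
def SobolevLoop : Type _ := {x : C(UnitAddCircle, M) // IsSobolevLoop E x}

variable {E M}

/-- The `W^{1,2}` distance `‖u - w‖_{L²} + ‖u' - w'‖_{L²}` between two real valued functions on
the circle `ℝ/ℤ`. -/
def sobolevDist (u w : UnitAddCircle → ℝ) : ℝ≥0∞ :=
  eLpNorm (fun s : ℝ => u s - w s) 2 (volume.restrict (Ioc 0 1)) +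
    eLpNorm (fun s : ℝ => deriv (fun r : ℝ => u r) s - deriv (fun r : ℝ => w r) s) 2
      (volume.restrict (Ioc 0 1))

/-- The `W^{1,2}` topology on `W^{1,2}(ℝ/ℤ, M)`: the coarsest topology for which all the maps
`x ↦ f ∘ x ∈ W^{1,2}(ℝ/ℤ, ℝ)`, with `f : M → ℝ` smooth, are continuous.  It is the topology induced
from `W^{1,2}(ℝ/ℤ, ℝᴺ)` by any smooth embedding of the closed manifold `M` into `ℝᴺ`, that is, the
topology which underlies the usual Hilbert manifold structure. -/
instance : TopologicalSpace (SobolevLoop E M) :=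
  TopologicalSpace.generateFrom
    {U | ∃ (f : C^∞⟮𝓘(ℝ, E), M; ℝ⟯) (x : SobolevLoop E M) (ε : ℝ≥0∞),
      U = {y : SobolevLoop E M | sobolevDist (fun t => f (x.1 t)) (fun t => f (y.1 t)) < ε}}

variable (E M) in
/-- The Hilbert manifold `W^{1,2}(ℝ/ℤ, M) × (0, ∞)` of loops with free period, with its product
topology. -/
abbrev LoopPeriod : Type _ := SobolevLoop E M × Ioi (0 : ℝ)

/-- The free period action functional
`S_κ(x, T) = T ∫ (L(x(s), x'(s) / T) + κ) ds`, the integral being over a period of `ℝ/ℤ`. -/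
def action (L : TangentBundle 𝓘(ℝ, E) M → ℝ) (κ : ℝ) (z : LoopPeriod E M) : ℝ :=
  (z.2 : ℝ) * ∫ s in (0 : ℝ)..1,
    (L ⟨z.1.1 (s : UnitAddCircle), (z.2 : ℝ)⁻¹ • velocity E z.1.1 s⟩ + κ)

/-- The lowest Mañé critical value `c_u(L)`: the infimum of the `κ` such that `S_κ` is nonnegative
on all pairs `(x, T)` with `x` a contractible (that is, freely null-homotopic) loop. -/
def lowestManeValue (L : TangentBundle 𝓘(ℝ, E) M → ℝ) : ℝ :=
  sInf {κ : ℝ | ∀ z : LoopPeriod E M, z.1.1.Nullhomotopic → 0 ≤ action L κ z}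

end Loops

end FreePeriod

end

/-! The action is additive under concatenation of curves, and repeating a closed curve `N` times
multiplies its action by `N`.

Suppose `κ ≥ c_u`, and let `w` lie in the component of `z`. The based loops `δ` of `w` and `γ` of
`z` satisfy `δ b = b γ` for some path class `b`, the track of the base point under a free homotopy.
Hence `δ b γ⁻¹ = b`. Fix once and for all a curve in the class `γ⁻¹`, of action `c`. If `A`, `A'`
are actions of curves in `b`, `b⁻¹`, then iterating the relation and closing up with `b⁻¹` gives
contractible loops of action `A + A' + N (S_κ(w) + c)`. These are all nonnegative, so `S_κ(w) ≥ -c`,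
a bound that depends on `z` only.

Suppose `κ < c_u`. Some contractible loop `w` has negative action. Following `γ`, then `b⁻¹`, then
`w` repeated `N` times, then `b`, with `b` a path from `w` to `z`, does not leave the free homotopy
class of `z`, while the action tends to `-∞`.

Two kinds of facts support this algebra. The analytic one is `exists_bounds`: `L` is bounded below
and grows at most quadratically in the velocity, so that the action of a `W^{1,2}` curve is a
genuine integral (`SobolevOn.intervalIntegrable`, `curveAction_concat`). The topological ones say
that every path class contains `W^{1,2}` curves (`exists_isActionOf`), and that components of the
loop space are free homotopy classes (`homotopic_of_mem_connectedComponent`, `joined_of_homotopic`).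
The latter reduce to `exists_pos_of_isPush`: a map uniformly close to another is moved onto it by
finitely many straight-line motions in charts. This replaces a tubular neighbourhood or geodesics.
-/

namespace FreePeriod

set_option linter.unusedSectionVars false

/-! ### Sobolev functions of one variable with values in a vector space -/

section Flat

variable {F : Type*} [NormedAddCommGroup F] [NormedSpace ℝ F] [FiniteDimensional ℝ F]
  {G : Type*} [NormedAddCommGroup G] [NormedSpace ℝ G] [FiniteDimensional ℝ G]

lemma memLp_two_iff {μ : Measure ℝ} {f : ℝ → F} :
    MemLp f 2 μ ↔ AEStronglyMeasurable f μ ∧ ∫⁻ s, ‖f s‖ₑ ^ 2 ∂μ < ⊤ := by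
  rw [MemLp, eLpNorm_lt_top_iff_lintegral_rpow_enorm_lt_top (by norm_num) (by norm_num)]
  simp

lemma aestronglyMeasurable_deriv_of_finiteDimensional (u : ℝ → F) (μ : Measure ℝ) :
    AEStronglyMeasurable (deriv u) μ := by
  borelize F
  have : ProperSpace F := FiniteDimensional.proper ℝ F
  have : CompleteSpace F := FiniteDimensional.complete ℝ F
  exact (measurable_deriv u).aestronglyMeasurable

/-- The class `W^{1,2}` of absolutely continuous functions on `[a, b]` with square integrable
derivative. -/
structure W12 (u : ℝ → F) (a b : ℝ) : Prop where
  ac : AbsolutelyContinuousOnInterval u a b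
  memLp : MemLp (deriv u) 2 (volume.restrict (Ioc a b))

variable {a b : ℝ}

lemma ae_differentiableAt_of_ac {u : ℝ → F} (hu : AbsolutelyContinuousOnInterval u a b) :
    ∀ᵐ s ∂volume.restrict (Ioc a b), DifferentiableAt ℝ u s := by
  rw [ae_restrict_iff' measurableSet_Ioc]
  filter_upwards [hu.boundedVariationOn.ae_differentiableAt_of_mem_uIcc] with s hs h
  exact hs (Icc_subset_uIcc (Ioc_subset_Icc_self h))

lemma absolutelyContinuousOnInterval_of_dist_le_add {X Y Z : Type*} [PseudoMetricSpace X]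
    [PseudoMetricSpace Y] [PseudoMetricSpace Z] {u : ℝ → X} {v : ℝ → Y} {w : ℝ → Z} {C : ℝ}
    (h : ∀ s ∈ uIcc a b, ∀ t ∈ uIcc a b,
      dist (w s) (w t) ≤ C * (dist (u s) (u t) + dist (v s) (v t)))
    (hu : AbsolutelyContinuousOnInterval u a b) (hv : AbsolutelyContinuousOnInterval v a b) :
    AbsolutelyContinuousOnInterval w a b := by
  rw [absolutelyContinuousOnInterval_iff] at hu hv ⊢
  intro ε hε
  obtain ⟨δ, hδ, h1⟩ := hu (ε / (2 * (|C| + 1))) (by positivity)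
  obtain ⟨δ', hδ', h2⟩ := hv (ε / (2 * (|C| + 1))) (by positivity)
  refine ⟨min δ δ', lt_min hδ hδ', fun I hI hI' => ?_⟩
  have h1 := h1 I hI (hI'.trans_le (min_le_left _ _))
  have h2 := h2 I hI (hI'.trans_le (min_le_right _ _))
  calc _ ≤ ∑ i ∈ Finset.range I.1, |C| * (dist (u (I.2 i).1) (u (I.2 i).2) +
          dist (v (I.2 i).1) (v (I.2 i).2)) := by
        refine Finset.sum_le_sum fun i hi => ?_
        refine (h _ (hI.1 i hi).1 _ (hI.1 i hi).2).trans ?_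
        gcongr
        exact le_abs_self C
    _ = |C| * (∑ i ∈ Finset.range I.1, dist (u (I.2 i).1) (u (I.2 i).2) +
          ∑ i ∈ Finset.range I.1, dist (v (I.2 i).1) (v (I.2 i).2)) := by
        rw [← Finset.mul_sum, Finset.sum_add_distrib]
    _ ≤ |C| * (ε / (2 * (|C| + 1)) + ε / (2 * (|C| + 1))) := by gcongr
    _ < (|C| + 1) * (ε / (2 * (|C| + 1)) + ε / (2 * (|C| + 1))) := by gcongr; linarith
    _ = ε := by field_simp; norm_num

lemma absolutelyContinuousOnInterval_const {X : Type*} [PseudoMetricSpace X] (x : X) :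
    AbsolutelyContinuousOnInterval (fun _ : ℝ => x) a b :=
  (LipschitzWith.const x).lipschitzOnWith.absolutelyContinuousOnInterval

lemma absolutelyContinuousOnInterval_of_dist_le {X Y : Type*} [PseudoMetricSpace X]
    [PseudoMetricSpace Y] {u : ℝ → X} {w : ℝ → Y} {C : ℝ}
    (h : ∀ s ∈ uIcc a b, ∀ t ∈ uIcc a b, dist (w s) (w t) ≤ C * dist (u s) (u t))
    (hu : AbsolutelyContinuousOnInterval u a b) : AbsolutelyContinuousOnInterval w a b :=
  absolutelyContinuousOnInterval_of_dist_le_add (v := fun _ => (0 : ℝ)) (C := C)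
    (by simpa using h) hu (absolutelyContinuousOnInterval_const 0)

/-- A monotone map sends disjoint half-open intervals to disjoint ones, and the Lipschitz constant
controls their total length. Strict monotonicity is not asked for, so that the clamps `min s b` and
`max s b` are allowed. -/
lemma AbsolutelyContinuousOnInterval.comp_monotone {X : Type*} [PseudoMetricSpace X]
    {u : ℝ → X} {c d : ℝ} (hu : AbsolutelyContinuousOnInterval u c d) {g : ℝ → ℝ}
    (hg : Monotone g) {K : NNReal} (hK : LipschitzWith K g)
    (hmap : ∀ s ∈ uIcc a b, g s ∈ uIcc c d) :
    AbsolutelyContinuousOnInterval (fun s => u (g s)) a b := by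
  rw [absolutelyContinuousOnInterval_iff] at hu ⊢
  intro ε hε
  obtain ⟨δ, hδ, h⟩ := hu ε hε
  refine ⟨δ / (K + 1), by positivity, fun I hI hI' => ?_⟩
  refine h (I.1, fun i => (g (I.2 i).1, g (I.2 i).2)) ⟨fun i hi =>
    ⟨hmap _ (hI.1 i hi).1, hmap _ (hI.1 i hi).2⟩, fun i hi j hj hij => ?_⟩ ?_
  · have h1 := hI.2 hi hj hij
    simp only [Function.onFun, Set.disjoint_left, uIoc, mem_Ioc] at h1 ⊢
    rintro p ⟨hp1, hp2⟩ ⟨hp3, hp4⟩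
    rw [← hg.map_min] at hp1 hp3
    rw [← hg.map_max] at hp2 hp4
    have k1 := hg.reflect_lt (hp1.trans_le hp2)
    have k2 := hg.reflect_lt (hp1.trans_le hp4)
    have k3 := hg.reflect_lt (hp3.trans_le hp2)
    have k4 := hg.reflect_lt (hp3.trans_le hp4)
    -- The smaller of the two right endpoints lies in both intervals, which contradicts
    -- disjointness.
    exact h1 (a := min (max (I.2 i).1 (I.2 i).2) (max (I.2 j).1 (I.2 j).2))
      ⟨lt_min k1 k2, min_le_left _ _⟩ ⟨lt_min k3 k4, min_le_right _ _⟩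
  · calc _ ≤ ∑ i ∈ Finset.range I.1, K * dist (I.2 i).1 (I.2 i).2 :=
          Finset.sum_le_sum fun i _ => hK.dist_le_mul _ _
      _ = K * ∑ i ∈ Finset.range I.1, dist (I.2 i).1 (I.2 i).2 := by rw [Finset.mul_sum]
      _ ≤ K * (δ / (K + 1)) := by gcongr
      _ < (K + 1) * (δ / (K + 1)) := by gcongr; linarith
      _ = δ := by field_simp

lemma continuousOn_of_ac {X : Type*} [PseudoMetricSpace X] {u : ℝ → X}
    (hu : AbsolutelyContinuousOnInterval u a b) : ContinuousOn u (uIcc a b) := by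
  rw [absolutelyContinuousOnInterval_iff] at hu
  rw [Metric.continuousOn_iff]
  intro t ht ε hε
  obtain ⟨δ, hδ, h⟩ := hu ε hε
  refine ⟨δ, hδ, fun s hs hst => ?_⟩
  simpa using h (1, fun _ => (s, t)) ⟨by simp [hs, ht], by simp⟩ (by simpa using hst)

/-- The clamped functions `u (min s b)` and `u (max s b)` are absolutely continuous on all of `[a,
c]`, and by the triangle inequality through `u b` their increments together dominate those of `u`.
-/
lemma AbsolutelyContinuousOnInterval.trans {X : Type*} [PseudoMetricSpace X] {u : ℝ → X} {c : ℝ}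
    (h1 : AbsolutelyContinuousOnInterval u a b) (h2 : AbsolutelyContinuousOnInterval u b c)
    (hab : a ≤ b) (hbc : b ≤ c) : AbsolutelyContinuousOnInterval u a c := by
  have k1 : AbsolutelyContinuousOnInterval (fun s => u (min s b)) a c :=
    AbsolutelyContinuousOnInterval.comp_monotone h1 (monotone_id.min monotone_const)
      (LipschitzWith.id.min_const b) fun s hs => by
        rw [uIcc_of_le (hab.trans hbc)] at hs
        rw [uIcc_of_le hab]
        exact ⟨le_min hs.1 hab, min_le_right _ _⟩
  have k2 : AbsolutelyContinuousOnInterval (fun s => u (max s b)) a c :=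
    AbsolutelyContinuousOnInterval.comp_monotone h2 (monotone_id.max monotone_const)
      (LipschitzWith.id.max_const b) fun s hs => by
        rw [uIcc_of_le (hab.trans hbc)] at hs
        rw [uIcc_of_le hbc]
        exact ⟨le_max_right _ _, max_le hs.2 hbc⟩
  refine absolutelyContinuousOnInterval_of_dist_le_add (C := 1) (fun s _ t _ => ?_) k1 k2
  rw [one_mul]
  rcases le_total s b with hs | hs <;> rcases le_total t b with ht | ht <;>
    simp only [min_eq_left, min_eq_right, max_eq_left, max_eq_right, hs, ht, dist_self, add_zero,
      zero_add, le_refl]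
  · exact dist_triangle _ _ _
  · rw [add_comm]; exact dist_triangle _ _ _

namespace W12

lemma continuousOn {u : ℝ → F} (hu : W12 u a b) : ContinuousOn u (uIcc a b) :=
  hu.ac.continuousOn

lemma ae_differentiableAt {u : ℝ → F} (hu : W12 u a b) :
    ∀ᵐ s ∂volume.restrict (Ioc a b), DifferentiableAt ℝ u s :=
  ae_differentiableAt_of_ac hu.ac

lemma of_bound {u : ℝ → G} (h : AbsolutelyContinuousOnInterval u a b) {g : ℝ → F}
    (hg : MemLp g 2 (volume.restrict (Ioc a b))) {C : ℝ}
    (h' : ∀ᵐ s ∂volume.restrict (Ioc a b), ‖deriv u s‖ ≤ C * ‖g s‖) : W12 u a b :=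
  ⟨h, hg.of_le_mul (aestronglyMeasurable_deriv_of_finiteDimensional _ _) h'⟩

lemma add {u w : ℝ → F} (hu : W12 u a b) (hw : W12 w a b) : W12 (fun s => u s + w s) a b := by
  refine ⟨hu.ac.add hw.ac, ?_⟩
  refine (hu.memLp.add hw.memLp).ae_eq ?_
  filter_upwards [hu.ae_differentiableAt, hw.ae_differentiableAt] with s h1 h2
  exact (h1.hasDerivAt.add h2.hasDerivAt).deriv.symm

lemma comp {u : ℝ → F} (hu : W12 u a b) {ψ : F → G} {K : NNReal} (hψ : LipschitzWith K ψ)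
    (hd : Differentiable ℝ ψ) : W12 (fun s => ψ (u s)) a b := by
  refine .of_bound (C := K) (absolutelyContinuousOnInterval_of_dist_le
    (fun s _ t _ => hψ.dist_le_mul _ _) hu.ac) hu.memLp ?_
  filter_upwards [hu.ae_differentiableAt] with s h
  have h1 : HasDerivAt (fun s => ψ (u s)) (fderiv ℝ ψ (u s) (deriv u s)) s :=
    (hd (u s)).hasFDerivAt.comp_hasDerivAt s h.hasDerivAt
  rw [h1.deriv]
  exact ((fderiv ℝ ψ (u s)).le_opNorm _).trans
    (by gcongr; exact norm_fderiv_le_of_lipschitz ℝ hψ)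

lemma const_smul {u : ℝ → F} (hu : W12 u a b) (r : ℝ) : W12 (fun s => r • u s) a b :=
  hu.comp (ψ := fun v => r • v) (lipschitzWith_smul r) (differentiable_id.const_smul r)

lemma neg {u : ℝ → F} (hu : W12 u a b) : W12 (fun s => - u s) a b := by
  simpa using hu.const_smul (-1)

lemma sub {u w : ℝ → F} (hu : W12 u a b) (hw : W12 w a b) : W12 (fun s => u s - w s) a b := by
  simpa [sub_eq_add_neg] using hu.add hw.neg

lemma smul {u : ℝ → ℝ} {w : ℝ → F} (hu : W12 u a b) (hw : W12 w a b) :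
    W12 (fun s => u s • w s) a b := by
  obtain ⟨C, hC⟩ := hu.ac.exists_bound
  obtain ⟨D, hD⟩ := hw.ac.exists_bound
  have hg : MemLp (fun s => C * ‖deriv w s‖ + D * ‖deriv u s‖) 2 (volume.restrict (Ioc a b)) :=
    (hw.memLp.norm.const_mul C).add (hu.memLp.norm.const_mul D)
  refine .of_bound (C := 1) (hu.ac.smul hw.ac) hg ?_
  filter_upwards [hu.ae_differentiableAt, hw.ae_differentiableAt,
    ae_restrict_mem measurableSet_Ioc] with s h1 h2 hs
  have hs' : s ∈ uIcc a b := Icc_subset_uIcc (Ioc_subset_Icc_self hs)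
  rw [(h1.hasDerivAt.fun_smul h2.hasDerivAt).deriv, one_mul]
  refine (norm_add_le _ _).trans (le_trans ?_ (le_abs_self _))
  rw [norm_smul, norm_smul, mul_comm ‖deriv u s‖]
  gcongr
  · exact hC s hs'
  · exact hD s hs'

lemma congr {u w : ℝ → F} (hu : W12 u a b) (h : EqOn u w (Icc a b)) (hab : a ≤ b) :
    W12 w a b := by
  have hd : ∀ s ∈ Ioo a b, deriv u s = deriv w s := fun s hs =>
    Filter.EventuallyEq.deriv_eq (h.eventuallyEq_of_mem (Icc_mem_nhds hs.1 hs.2))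
  refine ⟨?_, hu.memLp.ae_eq ?_⟩
  · have h1 := hu.ac
    rw [absolutelyContinuousOnInterval_iff] at h1 ⊢
    rw [← uIcc_of_le hab] at h
    intro ε hε
    obtain ⟨δ, hδ, h2⟩ := h1 ε hε
    refine ⟨δ, hδ, fun I hI hI' => lt_of_eq_of_lt (Finset.sum_congr rfl fun i hi => ?_)
      (h2 I hI hI')⟩
    rw [h (hI.1 i hi).1, h (hI.1 i hi).2]
  · rw [← restrict_Ioo_eq_restrict_Ioc]
    filter_upwards [ae_restrict_mem measurableSet_Ioo] with s hs using hd s hs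

/-- Sobolev embedding in dimension one. -/
lemma enorm_le {u : ℝ → ℝ} (hu : W12 u 0 1) {s : ℝ} (hs : s ∈ Icc (0 : ℝ) 1) :
    ‖u s‖ₑ ≤ eLpNorm u 2 (volume.restrict (Ioc 0 1)) +
      eLpNorm (deriv u) 2 (volume.restrict (Ioc 0 1)) := by
  have : IsProbabilityMeasure (volume.restrict (Ioc (0 : ℝ) 1)) := ⟨by simp⟩
  have hm : AEStronglyMeasurable u (volume.restrict (Ioc 0 1)) :=
    (hu.continuousOn.mono (by rw [uIcc_of_le zero_le_one]; exact Ioc_subset_Icc_self)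
      ).aestronglyMeasurable measurableSet_Ioc
  -- Some point has `|u t|` at most the mean of `|u|`. The value at `s` differs from it by an
  -- integral of the derivative.
  obtain ⟨t, ht, htu⟩ : ∃ t ∈ Ioc (0 : ℝ) 1, ‖u t‖ₑ ≤ eLpNorm u 1 (volume.restrict (Ioc 0 1)) := by
    rw [eLpNorm_one_eq_lintegral_enorm]
    have := exists_le_setLAverage (μ := volume) (s := Ioc (0 : ℝ) 1) (f := fun t => ‖u t‖ₑ)
      (by simp) (by simp) hm.enorm
    simpa [setLAverage_eq] using this
  have h1 : ‖u s - u t‖ₑ ≤ eLpNorm (deriv u) 1 (volume.restrict (Ioc 0 1)) := by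
    have hsub : uIcc t s ⊆ uIcc 0 1 := by
      rw [uIcc_of_le zero_le_one]
      exact ordConnected_Icc.uIcc_subset (Ioc_subset_Icc_self ht) hs
    rw [← (hu.ac.mono hsub).integral_deriv_eq_sub, eLpNorm_one_eq_lintegral_enorm]
    rw [← ofReal_norm, intervalIntegral.norm_intervalIntegral_eq, ofReal_norm]
    refine (enorm_integral_le_lintegral_enorm _).trans (lintegral_mono_set ?_)
    intro x hx
    simp only [mem_uIoc, mem_Ioc, mem_Icc] at *
    grind
  calc ‖u s‖ₑ = ‖u t + (u s - u t)‖ₑ := by congr 1; ring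
    _ ≤ _ := enorm_add_le _ _
    _ ≤ _ := add_le_add htu h1
    _ ≤ _ := add_le_add (eLpNorm_le_eLpNorm_of_exponent_le (by norm_num) hm)
      (eLpNorm_le_eLpNorm_of_exponent_le (by norm_num)
        (aestronglyMeasurable_deriv_of_finiteDimensional _ _))

end W12

lemma tendsto_eLpNorm_two_zero {ι : Type*} {l : Filter ι} [l.IsCountablyGenerated]
    {μ : Measure ℝ} {f : ι → ℝ → F} {g : ℝ → ℝ} (hg : MemLp g 2 μ)
    (hf : ∀ i, AEStronglyMeasurable (f i) μ) (hb : ∀ᶠ i in l, ∀ᵐ s ∂μ, ‖f i s‖ ≤ g s)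
    (hlim : ∀ᵐ s ∂μ, Tendsto (fun i => f i s) l (𝓝 0)) :
    Tendsto (fun i => eLpNorm (f i) 2 μ) l (𝓝 0) := by
  have h2 : Tendsto (fun i => ∫⁻ s, ‖f i s‖ₑ ^ 2 ∂μ) l (𝓝 (∫⁻ _, 0 ∂μ)) := by
    refine tendsto_lintegral_filter_of_dominated_convergence' (fun s => ‖g s‖ₑ ^ 2)
      (Eventually.of_forall fun i => ((hf i).enorm.pow_const 2)) ?_ (memLp_two_iff.1 hg).2.ne ?_
    · filter_upwards [hb] with i hi
      filter_upwards [hi] with s hs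
      gcongr
      exact enorm_le_iff_norm_le.2 (hs.trans (le_abs_self _))
    · filter_upwards [hlim] with s hs
      have h3 : Tendsto (fun i => ‖f i s‖ₑ) l (𝓝 0) := by
        simpa using hs.enorm
      simpa using ENNReal.Tendsto.pow (n := 2) h3
  have h4 : ∀ i, eLpNorm (f i) 2 μ = (∫⁻ s, ‖f i s‖ₑ ^ 2 ∂μ) ^ (1 / 2 : ℝ) := fun i => by
    rw [eLpNorm_eq_lintegral_rpow_enorm_toReal (by norm_num) (by norm_num)]
    simp
  simp_rw [h4]
  rw [lintegral_zero] at h2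
  have h5 := (ENNReal.continuous_rpow_const (y := (1 / 2 : ℝ))).tendsto (0 : ℝ≥0∞)
  rw [ENNReal.zero_rpow_of_pos (by norm_num)] at h5
  exact h5.comp h2

/-- Compositions of a fixed smooth Lipschitz function with an affine family in `W^{1,2}` depend
continuously on the parameter. -/
lemma tendsto_comp_affine {c : ℝ → G} {w k : ℝ → F} (hc : W12 c 0 1) (hw : W12 w 0 1)
    (hk : W12 k 0 1) {ψ : F → G} {K : NNReal} (hψ : LipschitzWith K ψ) (hd : ContDiff ℝ 1 ψ)
    (r₀ : ℝ) :
    Tendsto (fun r : ℝ =>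
      eLpNorm (fun s => (c s + ψ (w s + r₀ • k s)) - (c s + ψ (w s + r • k s))) 2
        (volume.restrict (Ioc 0 1)) +
      eLpNorm (fun s => deriv (fun s => c s + ψ (w s + r₀ • k s)) s -
        deriv (fun s => c s + ψ (w s + r • k s)) s) 2 (volume.restrict (Ioc 0 1)))
      (𝓝 r₀) (𝓝 0) := by
  have : IsProbabilityMeasure (volume.restrict (Ioc (0 : ℝ) 1)) := ⟨by simp⟩
  have hcont : ∀ {u : ℝ → G}, W12 u 0 1 → AEStronglyMeasurable u (volume.restrict (Ioc 0 1)) :=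
    fun hu => (hu.continuousOn.mono (by rw [uIcc_of_le zero_le_one]; exact Ioc_subset_Icc_self)
      ).aestronglyMeasurable measurableSet_Ioc
  have hu : ∀ r : ℝ, W12 (fun s => c s + ψ (w s + r • k s)) 0 1 := fun r =>
    hc.add ((hw.add (hk.const_smul r)).comp hψ (hd.differentiable one_ne_zero))
  rw [show (0 : ℝ≥0∞) = 0 + 0 by simp]
  refine Tendsto.add ?_ ?_
  · obtain ⟨D, hD⟩ := hk.ac.exists_bound
    refine tendsto_eLpNorm_two_zero (g := fun _ => K * (1 * D)) (memLp_const _)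
      (fun r => hcont ((hu r₀).sub (hu r))) ?_ (Eventually.of_forall fun s => ?_)
    · filter_upwards [Metric.ball_mem_nhds r₀ one_pos] with r hr
      filter_upwards [ae_restrict_mem measurableSet_Ioc] with s hs
      have h1 := hψ.dist_le_mul (w s + r₀ • k s) (w s + r • k s)
      rw [dist_eq_norm, dist_eq_norm, add_sub_add_left_eq_sub, ← sub_smul, norm_smul] at h1
      rw [add_sub_add_left_eq_sub]
      refine h1.trans ?_
      gcongr
      · exact (dist_comm r r₀ ▸ (Metric.mem_ball.1 hr)).le
      · exact hD s (Icc_subset_uIcc (Ioc_subset_Icc_self hs))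
    · have h : Continuous fun r : ℝ => (c s + ψ (w s + r₀ • k s)) - (c s + ψ (w s + r • k s)) := by
        have := hd.continuous
        fun_prop
      simpa using h.tendsto r₀
  -- The exceptional null set must not depend on `r`, since the limit in `r` is taken at fixed `s`.
  · have hder : ∀ᵐ s ∂volume.restrict (Ioc (0 : ℝ) 1), ∀ r : ℝ,
        deriv (fun s => c s + ψ (w s + r • k s)) s =
          deriv c s + fderiv ℝ ψ (w s + r • k s) (deriv w s + r • deriv k s) := by
      filter_upwards [hc.ae_differentiableAt, hw.ae_differentiableAt, hk.ae_differentiableAt]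
        with s h1 h2 h3 r
      have h4 : HasDerivAt (fun s => ψ (w s + r • k s)) _ s :=
        ((hd.differentiable one_ne_zero) (w s + r • k s)).hasFDerivAt.comp_hasDerivAt s
          (h2.hasDerivAt.add (h3.hasDerivAt.const_smul r))
      exact (h1.hasDerivAt.add h4).deriv
    have hK : ∀ v, ‖fderiv ℝ ψ v‖ ≤ K := fun v => norm_fderiv_le_of_lipschitz ℝ hψ
    refine tendsto_eLpNorm_two_zero
      -- The two summands dominate the derivatives at `r₀` and at `r`, using `|r| ≤ |r₀| + 1` for
      -- `r` in the unit ball about `r₀`.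
      (g := fun s => K * (‖deriv w s‖ + |r₀| * ‖deriv k s‖) +
        K * (‖deriv w s‖ + (|r₀| + 1) * ‖deriv k s‖)) ?_
      (fun r => (aestronglyMeasurable_deriv_of_finiteDimensional _ _).sub
        (aestronglyMeasurable_deriv_of_finiteDimensional _ _)) ?_ ?_
    · exact ((hw.memLp.norm.add (hk.memLp.norm.const_mul _)).const_mul _).add
        ((hw.memLp.norm.add (hk.memLp.norm.const_mul _)).const_mul _)
    · filter_upwards [Metric.ball_mem_nhds r₀ one_pos] with r hr
      filter_upwards [hder] with s hs
      rw [hs, hs, add_sub_add_left_eq_sub]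
      have hr' : |r| ≤ |r₀| + 1 := by
        have := abs_sub_abs_le_abs_sub r r₀
        rw [Metric.mem_ball, Real.dist_eq] at hr
        linarith
      have hb : ∀ (r C : ℝ), |r| ≤ C →
          ‖fderiv ℝ ψ (w s + r • k s) (deriv w s + r • deriv k s)‖ ≤
            K * (‖deriv w s‖ + C * ‖deriv k s‖) := fun r C hC => by
        refine (ContinuousLinearMap.le_opNorm _ _).trans ?_
        gcongr
        · exact hK _
        · refine (norm_add_le _ _).trans ?_
          rw [norm_smul, Real.norm_eq_abs]
          gcongr
      exact (norm_sub_le _ _).trans (add_le_add (hb _ _ le_rfl) (hb _ _ hr'))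
    · filter_upwards [hder] with s hs
      simp only [hs]
      have h : Continuous fun r : ℝ =>
          (deriv c s + fderiv ℝ ψ (w s + r₀ • k s) (deriv w s + r₀ • deriv k s)) -
          (deriv c s + fderiv ℝ ψ (w s + r • k s) (deriv w s + r • deriv k s)) := by
        have := hd.continuous_fderiv one_ne_zero
        fun_prop
      simpa using h.tendsto r₀

end Flat

/-! ### Tangent vectors in charts and bounds on differentials -/

section Geometry

variable {E : Type*} [NormedAddCommGroup E] [NormedSpace ℝ E]
  {M : Type*} [TopologicalSpace M] [ChartedSpace E M] [IsManifold 𝓘(ℝ, E) ∞ M]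
  {F : Type*} [NormedAddCommGroup F] [NormedSpace ℝ F]

/-- The coordinates of a tangent vector in the chart at `c`. -/
noncomputable def tangentCoord (c : M) (z : TangentBundle 𝓘(ℝ, E) M) : E :=
  (trivializationAt E (TangentSpace 𝓘(ℝ, E)) c z).2

lemma tangentCoord_eq_mfderiv {c y : M} (hy : y ∈ (chartAt E c).source)
    (v : TangentSpace 𝓘(ℝ, E) y) :
    tangentCoord c ⟨y, v⟩ = mfderiv 𝓘(ℝ, E) 𝓘(ℝ, E) (extChartAt 𝓘(ℝ, E) c) y v := by
  rw [← TangentBundle.continuousLinearMapAt_trivializationAt hy]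
  have h : y ∈ (trivializationAt E (TangentSpace 𝓘(ℝ, E)) c).baseSet := by simpa using hy
  exact (Trivialization.continuousLinearMapAt_apply_of_mem ℝ _ h v).symm

lemma mfderiv_eq_fderiv_tangentCoord {c y : M} (hy : y ∈ (chartAt E c).source) {f : M → F}
    (hf : MDifferentiableAt 𝓘(ℝ, E) 𝓘(ℝ, F) f y) (v : TangentSpace 𝓘(ℝ, E) y) :
    mfderiv 𝓘(ℝ, E) 𝓘(ℝ, F) f y v =
      fderiv ℝ (f ∘ (extChartAt 𝓘(ℝ, E) c).symm) (extChartAt 𝓘(ℝ, E) c y)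
        (tangentCoord c ⟨y, v⟩) := by
  have hy' : y ∈ (extChartAt 𝓘(ℝ, E) c).source := by rwa [extChartAt_source]
  have hs : MDifferentiableAt 𝓘(ℝ, E) 𝓘(ℝ, E) (extChartAt 𝓘(ℝ, E) c).symm
      (extChartAt 𝓘(ℝ, E) c y) := by
    have := mdifferentiableWithinAt_extChartAt_symm (I := 𝓘(ℝ, E)) (x := c)
      ((extChartAt 𝓘(ℝ, E) c).map_source hy')
    rwa [ModelWithCorners.range_eq_univ, mdifferentiableWithinAt_univ] at this
  have hf' : MDifferentiableAt 𝓘(ℝ, E) 𝓘(ℝ, F) f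
      ((extChartAt 𝓘(ℝ, E) c).symm (extChartAt 𝓘(ℝ, E) c y)) := by
    rwa [(extChartAt 𝓘(ℝ, E) c).left_inv hy']
  have hg := hf'.comp _ hs
  have he : MDifferentiableAt 𝓘(ℝ, E) 𝓘(ℝ, E) (extChartAt 𝓘(ℝ, E) c) y :=
    mdifferentiableAt_extChartAt hy
  have h1 : f =ᶠ[𝓝 y] (f ∘ (extChartAt 𝓘(ℝ, E) c).symm) ∘ (extChartAt 𝓘(ℝ, E) c) := by
    filter_upwards [extChartAt_source_mem_nhds' (I := 𝓘(ℝ, E)) hy'] with z hz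
    exact (congrArg f ((extChartAt 𝓘(ℝ, E) c).left_inv hz)).symm
  have h2 : mfderiv 𝓘(ℝ, E) 𝓘(ℝ, F) ((f ∘ (extChartAt 𝓘(ℝ, E) c).symm) ∘ (extChartAt 𝓘(ℝ, E) c)) y
    = _ := mfderiv_comp y hg he
  rw [tangentCoord_eq_mfderiv hy]
  have h3 : mfderiv 𝓘(ℝ, E) 𝓘(ℝ, F) f y v = mfderiv 𝓘(ℝ, E) 𝓘(ℝ, F)
      ((f ∘ (extChartAt 𝓘(ℝ, E) c).symm) ∘ (extChartAt 𝓘(ℝ, E) c)) y v := by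
    have := h1.mfderiv_eq (I := 𝓘(ℝ, E)) (I' := 𝓘(ℝ, F))
    exact congrArg (fun A : E →L[ℝ] F => A v) this
  rw [h3]
  rw [← mfderiv_eq_fderiv]
  exact congrArg (fun A : E →L[ℝ] F => A v) h2

variable [RiemannianBundle (fun x : M => TangentSpace 𝓘(ℝ, E) x)]
  [IsContMDiffRiemannianBundle 𝓘(ℝ, E) ∞ E (fun x : M => TangentSpace 𝓘(ℝ, E) x)]

variable (E) in
lemma isContinuousRiemannianBundle_tangent :
    IsContinuousRiemannianBundle E (fun x : M => TangentSpace 𝓘(ℝ, E) x) := by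
  obtain ⟨g, hg, h⟩ := IsContMDiffRiemannianBundle.exists_contMDiff (IB := 𝓘(ℝ, E)) (n := ∞)
    (F := E) (E := fun x : M => TangentSpace 𝓘(ℝ, E) x)
  exact ⟨g, hg.continuous, h⟩

lemma eventually_norm_tangentCoord (c : M) :
    ∃ C : ℝ, ∀ᶠ y in 𝓝 c, ∀ v : TangentSpace 𝓘(ℝ, E) y,
      ‖tangentCoord c ⟨y, v⟩‖ ≤ C * ‖v‖ ∧ ‖v‖ ≤ C * ‖tangentCoord c ⟨y, v⟩‖ := by
  have := isContinuousRiemannianBundle_tangent E (M := M)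
  obtain ⟨C, hC, h⟩ := eventually_norm_trivializationAt_lt E
    (fun x : M => TangentSpace 𝓘(ℝ, E) x) c
  obtain ⟨D, hD, h'⟩ := eventually_norm_symmL_trivializationAt_lt E
    (fun x : M => TangentSpace 𝓘(ℝ, E) x) c
  refine ⟨max C D, ?_⟩
  filter_upwards [h, h', (chartAt E c).open_source.mem_nhds (mem_chart_source E c)]
    with y h1 h2 hy v
  have hb : y ∈ (trivializationAt E (TangentSpace 𝓘(ℝ, E)) c).baseSet := by simpa using hy
  have e1 : tangentCoord c ⟨y, v⟩ =
      (trivializationAt E (TangentSpace 𝓘(ℝ, E)) c).continuousLinearMapAt ℝ y v :=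
    (Trivialization.continuousLinearMapAt_apply_of_mem ℝ _ hb v).symm
  constructor
  · rw [e1]
    refine (ContinuousLinearMap.le_opNorm _ v).trans ?_
    gcongr
    exact h1.le.trans (le_max_left _ _)
  · have e2 : v = (trivializationAt E (TangentSpace 𝓘(ℝ, E)) c).symmL ℝ y
        (tangentCoord c ⟨y, v⟩) := by
      rw [e1]
      exact (Trivialization.symmL_continuousLinearMapAt _ hb v).symm
    conv_lhs => rw [e2]
    refine (ContinuousLinearMap.le_opNorm _ (tangentCoord c ⟨y, v⟩)).trans ?_
    gcongr
    exact h2.le.trans (le_max_right _ _)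

/-- Compactness turns local bounds into a global one, for properties that persist when the constant
grows. -/
lemma exists_bound_of_locally {X : Type*} [TopologicalSpace X] [CompactSpace X]
    {p : X → ℝ → Prop} (mono : ∀ x C C', C ≤ C' → p x C → p x C')
    (h : ∀ x, ∃ C, ∀ᶠ y in 𝓝 x, p y C) : ∃ C, 0 < C ∧ ∀ x, p x C := by
  suffices ∃ C, 0 < C ∧ ∀ x ∈ (univ : Set X), p x C by simpa using this
  refine isCompact_univ.induction_on (p := fun s => ∃ C, 0 < C ∧ ∀ x ∈ s, p x C)
    ⟨1, one_pos, by simp⟩ ?_ ?_ ?_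
  · rintro s t hst ⟨C, h0, hC⟩
    exact ⟨C, h0, fun x hx => hC x (hst hx)⟩
  · rintro s t ⟨C, h0, hC⟩ ⟨D, -, hD⟩
    refine ⟨max C D, lt_max_of_lt_left h0, ?_⟩
    rintro x (hx | hx)
    · exact mono _ _ _ (le_max_left _ _) (hC x hx)
    · exact mono _ _ _ (le_max_right _ _) (hD x hx)
  · intro x _
    obtain ⟨C, hC⟩ := h x
    exact ⟨{y | p y C}, mem_nhdsWithin_of_mem_nhds hC, max C 1, by positivity,
      fun y hy => mono _ _ _ (le_max_left _ _) hy⟩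

lemma exists_norm_mfderiv_le [CompactSpace M] {f : M → F}
    (hf : ContMDiff 𝓘(ℝ, E) 𝓘(ℝ, F) ∞ f) :
    ∃ C : ℝ, 0 < C ∧ ∀ (x : M) (v : TangentSpace 𝓘(ℝ, E) x),
      ‖(show F from mfderiv 𝓘(ℝ, E) 𝓘(ℝ, F) f x v)‖ ≤ C * ‖v‖ := by
  refine exists_bound_of_locally (p := fun x C => ∀ (v : TangentSpace 𝓘(ℝ, E) x),
      ‖(show F from mfderiv 𝓘(ℝ, E) 𝓘(ℝ, F) f x v)‖ ≤ C * ‖v‖)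
    (fun x C C' h hC v => (hC v).trans (by gcongr)) fun c => ?_
  obtain ⟨C, hC⟩ := eventually_norm_tangentCoord (E := E) c
  have hsm : ContDiffAt ℝ ∞ (f ∘ (extChartAt 𝓘(ℝ, E) c).symm) (extChartAt 𝓘(ℝ, E) c c) := by
    rw [← contMDiffAt_iff_contDiffAt]
    refine hf.contMDiffAt.comp _ ?_
    have := contMDiffOn_extChartAt_symm (I := 𝓘(ℝ, E)) (n := ∞) c
    exact this.contMDiffAt (extChartAt_target_mem_nhds c)
  have hcont : ContinuousAt (fun y => ‖fderiv ℝ (f ∘ (extChartAt 𝓘(ℝ, E) c).symm)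
      (extChartAt 𝓘(ℝ, E) c y)‖) c :=
    (ContinuousAt.comp (g := fderiv ℝ (f ∘ (extChartAt 𝓘(ℝ, E) c).symm))
      (hsm.fderiv_right (m := 0) (by simp)).continuousAt (continuousAt_extChartAt c)).norm
  set D := ‖fderiv ℝ (f ∘ (extChartAt 𝓘(ℝ, E) c).symm) (extChartAt 𝓘(ℝ, E) c c)‖ + 1
  refine ⟨D * C, ?_⟩
  filter_upwards [hC, hcont.eventually_le_const (lt_add_one _),
    (chartAt E c).open_source.mem_nhds (mem_chart_source E c)] with y h1 h2 hy v
  rw [mfderiv_eq_fderiv_tangentCoord hy (hf.mdifferentiable (by simp) y)]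
  refine (ContinuousLinearMap.le_opNorm _ _).trans ?_
  rw [mul_assoc]
  gcongr
  exact (h1 v).1

end Geometry

/-! ### Smooth maps and charts compared with the Riemannian distance -/

section Metric

variable {E : Type*} [NormedAddCommGroup E] [NormedSpace ℝ E]
  {M : Type*} [MetricSpace M] [ChartedSpace E M] [IsManifold 𝓘(ℝ, E) ∞ M]
  {F : Type*} [NormedAddCommGroup F] [NormedSpace ℝ F]
  [RiemannianBundle (fun x : M => TangentSpace 𝓘(ℝ, E) x)]
  [IsContMDiffRiemannianBundle 𝓘(ℝ, E) ∞ E (fun x : M => TangentSpace 𝓘(ℝ, E) x)]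
  [IsRiemannianManifold 𝓘(ℝ, E) M]

/-- The bound on the differential is integrated along `C^1` curves whose length is arbitrarily close
to the distance. -/
lemma exists_lipschitzWith [CompactSpace M] {f : M → F}
    (hf : ContMDiff 𝓘(ℝ, E) 𝓘(ℝ, F) ∞ f) : ∃ C : NNReal, LipschitzWith C f := by
  obtain ⟨C, hC0, hC⟩ := exists_norm_mfderiv_le hf
  lift C to NNReal using hC0.le
  refine ⟨C, fun x y => ?_⟩
  rw [IsRiemannianManifold.out (I := 𝓘(ℝ, E)) x y, mul_comm]
  rw [← ENNReal.div_le_iff (by simpa using (NNReal.coe_pos.1 hC0).ne') (by simp)]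
  refine le_of_forall_gt fun r hr => ?_
  obtain ⟨γ, hx, hy, hγ, hlen⟩ := Manifold.exists_lt_of_riemannianEDist_lt hr
  refine lt_of_le_of_lt ?_ hlen
  rw [ENNReal.div_le_iff (by simpa using (NNReal.coe_pos.1 hC0).ne') (by simp), mul_comm]
  have hfγ : ContDiffOn ℝ 1 (f ∘ γ) (Icc 0 1) := by
    rw [← contMDiffOn_iff_contDiffOn]
    exact (hf.of_le (by simp)).comp_contMDiffOn hγ
  have h1 := enorm_sub_le_lintegral_derivWithin_Icc_of_contDiffOn_Icc hfγ zero_le_one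
  rw [Function.comp, Function.comp, hx, hy, ← edist_eq_enorm_sub, edist_comm] at h1
  refine h1.trans ?_
  rw [Manifold.pathELength_eq_lintegral_mfderivWithin_Icc,
    ← lintegral_const_mul' _ _ ENNReal.coe_ne_top]
  refine setLIntegral_mono' measurableSet_Icc fun t ht => ?_
  have hd : UniqueMDiffWithinAt 𝓘(ℝ, ℝ) (Icc (0 : ℝ) 1) t := by
    rw [uniqueMDiffWithinAt_iff_uniqueDiffWithinAt]
    exact uniqueDiffOn_Icc zero_lt_one t ht
  have h2 : mfderivWithin 𝓘(ℝ, ℝ) 𝓘(ℝ, F) (f ∘ γ) (Icc 0 1) t = _ :=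
    mfderiv_comp_mfderivWithin t (hf.mdifferentiable (by simp) (γ t))
      (hγ.mdifferentiableOn one_ne_zero t ht) hd
  have h3 : derivWithin (f ∘ γ) (Icc 0 1) t = (show F from mfderiv 𝓘(ℝ, E) 𝓘(ℝ, F) f (γ t)
      (mfderivWithin 𝓘(ℝ, ℝ) 𝓘(ℝ, E) γ (Icc 0 1) t (1 : ℝ))) := by
    rw [← fderivWithin_derivWithin, ← mfderivWithin_eq_fderivWithin]
    exact congrArg (fun A : ℝ →L[ℝ] F => A 1) h2
  have h4 := hC (γ t) (mfderivWithin 𝓘(ℝ, ℝ) 𝓘(ℝ, E) γ (Icc 0 1) t (1 : ℝ))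
  rw [← h3] at h4
  rw [← ofReal_norm, ← ofReal_norm, ← ENNReal.ofReal_coe_nnreal, ← ENNReal.ofReal_mul (by simp)]
  exact ENNReal.ofReal_le_ofReal h4

/-- The inverse of a chart is locally Lipschitz. -/
lemma exists_nhds_dist_le_extChartAt (c : M) :
    ∃ C : ℝ, 0 ≤ C ∧ ∃ V ∈ 𝓝 c, ∀ y ∈ V, ∀ z ∈ V,
      dist y z ≤ C * dist (extChartAt 𝓘(ℝ, E) c y) (extChartAt 𝓘(ℝ, E) c z) := by
  obtain ⟨C, hC⟩ := eventually_norm_tangentCoord (E := E) c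
  have hC0 : (0 : ℝ) ≤ max C 0 := le_max_right _ _
  set φ := extChartAt 𝓘(ℝ, E) c with hφ
  obtain ⟨r, hr, hball⟩ : ∃ r > 0, Metric.ball (φ c) r ⊆ φ.target ∩
      {e | ∀ v : TangentSpace 𝓘(ℝ, E) (φ.symm e),
        ‖v‖ ≤ C * ‖tangentCoord c ⟨φ.symm e, v⟩‖} := by
    refine Metric.mem_nhds_iff.1 (inter_mem (extChartAt_target_mem_nhds c) ?_)
    have h1 : Tendsto φ.symm (𝓝 (φ c)) (𝓝 c) := by
      have := continuousAt_extChartAt_symm (I := 𝓘(ℝ, E)) c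
      rwa [ContinuousAt, ← hφ, φ.left_inv (mem_extChartAt_source c)] at this
    filter_upwards [h1.eventually hC] with e he v using (he v).2
  refine ⟨max C 0, hC0, φ.source ∩ φ ⁻¹' Metric.ball (φ c) r, inter_mem
    (extChartAt_source_mem_nhds c)
    ((continuousAt_extChartAt c).preimage_mem_nhds (Metric.ball_mem_nhds _ hr)), ?_⟩
  rintro y ⟨hys, hy⟩ z ⟨hzs, hz⟩
  -- The segment between the two coordinate points stays in the convex ball, and the length of its
  -- image under the inverse chart bounds the distance from above.
  let η : ℝ → E := AffineMap.lineMap (φ y) (φ z)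
  have hη : ∀ t ∈ Icc (0 : ℝ) 1, η t ∈ Metric.ball (φ c) r := fun t ht =>
    (convex_ball (φ c) r).lineMap_mem hy hz ht
  have hηs : ContDiff ℝ 1 η := by
    have := (ContinuousAffineMap.lineMap (R := ℝ) (φ y) (φ z)).contDiff (n := 1)
    rwa [ContinuousAffineMap.coe_lineMap_eq] at this
  have hηd : ∀ t, HasDerivAt η (φ z - φ y) t := fun t => AffineMap.hasDerivAt_lineMap
  let γ : ℝ → M := φ.symm ∘ η
  have hγ : ContMDiffOn 𝓘(ℝ, ℝ) 𝓘(ℝ, E) 1 γ (Icc 0 1) :=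
    (contMDiffOn_extChartAt_symm c).comp hηs.contMDiff.contMDiffOn
      fun t ht => (hball (hη t ht)).1
  have hlen : edist y z ≤ Manifold.pathELength 𝓘(ℝ, E) γ 0 1 := by
    rw [IsRiemannianManifold.out (I := 𝓘(ℝ, E)) y z]
    refine Manifold.riemannianEDist_le_pathELength hγ ?_ ?_ zero_le_one
    · simp only [γ, η, Function.comp, AffineMap.lineMap_apply_zero]
      exact φ.left_inv hys
    · simp only [γ, η, Function.comp, AffineMap.lineMap_apply_one]
      exact φ.left_inv hzs
  have hb : Manifold.pathELength 𝓘(ℝ, E) γ 0 1 ≤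
      ∫⁻ _ in Icc (0 : ℝ) 1, ENNReal.ofReal (max C 0 * dist (φ y) (φ z)) := by
    rw [Manifold.pathELength_eq_lintegral_mfderivWithin_Icc]
    refine setLIntegral_mono' measurableSet_Icc fun t ht => ?_
    rw [← ofReal_norm]
    refine ENNReal.ofReal_le_ofReal (((hball (hη t ht)).2 _).trans ?_)
    have hs : γ t ∈ φ.source := φ.map_target (hball (hη t ht)).1
    have hs' : γ t ∈ (chartAt E c).source := by rwa [hφ, extChartAt_source] at hs
    have hd : UniqueMDiffWithinAt 𝓘(ℝ, ℝ) (Icc (0 : ℝ) 1) t := by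
      rw [uniqueMDiffWithinAt_iff_uniqueDiffWithinAt]
      exact uniqueDiffOn_Icc zero_lt_one t ht
    have h2 : mfderivWithin 𝓘(ℝ, ℝ) 𝓘(ℝ, E) (φ ∘ γ) (Icc 0 1) t = _ :=
      mfderiv_comp_mfderivWithin t (mdifferentiableAt_extChartAt hs')
        (hγ.mdifferentiableOn one_ne_zero t ht) hd
    have h3 : derivWithin (φ ∘ γ) (Icc 0 1) t = tangentCoord c ⟨γ t,
        mfderivWithin 𝓘(ℝ, ℝ) 𝓘(ℝ, E) γ (Icc 0 1) t (1 : ℝ)⟩ := by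
      rw [← fderivWithin_derivWithin, ← mfderivWithin_eq_fderivWithin, tangentCoord_eq_mfderiv hs']
      exact congrArg (fun A : ℝ →L[ℝ] E => A 1) h2
    have h4 : derivWithin (φ ∘ γ) (Icc 0 1) t = φ z - φ y := by
      have h5 : EqOn (φ ∘ γ) η (Icc 0 1) := fun s hs => φ.right_inv (hball (hη s hs)).1
      rw [derivWithin_congr h5 (h5 ht)]
      exact (hηd t).hasDerivWithinAt.derivWithin (uniqueDiffOn_Icc zero_lt_one t ht)
    have h6 : C * ‖tangentCoord c ⟨γ t, mfderivWithin 𝓘(ℝ, ℝ) 𝓘(ℝ, E) γ (Icc 0 1) t (1 : ℝ)⟩‖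
        ≤ max C 0 * dist (φ y) (φ z) := by
      rw [← h3, h4, dist_comm, dist_eq_norm]
      gcongr
      exact le_max_left _ _
    exact h6
  have h := hlen.trans hb
  simp only [lintegral_const, MeasurableSet.univ, Measure.restrict_apply, univ_inter,
    Real.volume_Icc, sub_zero, ENNReal.ofReal_one, mul_one] at h
  rw [edist_dist] at h
  exact (ENNReal.ofReal_le_ofReal_iff (by positivity)).1 h

/-- A smooth bi-Lipschitz immersion of `M` into a vector space. -/
structure IsGoodEmbedding (e : M → F) (C : ℝ) : Prop where
  nonneg : 0 ≤ C
  contMDiff : ContMDiff 𝓘(ℝ, E) 𝓘(ℝ, F) ∞ e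
  dist_le : ∀ x y, dist x y ≤ C * dist (e x) (e y)
  mdifferentiableAt : ∀ (X : ℝ → M) (t : ℝ), ContinuousAt X t →
    DifferentiableAt ℝ (e ∘ X) t → MDifferentiableAt 𝓘(ℝ, ℝ) 𝓘(ℝ, E) X t
  norm_le : ∀ (x : M) (v : TangentSpace 𝓘(ℝ, E) x),
    ‖v‖ ≤ C * ‖(show F from mfderiv 𝓘(ℝ, E) 𝓘(ℝ, F) e x v)‖

end Metric

/-! ### A smooth bi-Lipschitz embedding into a Euclidean space -/

section Embedding

variable {E : Type*} [NormedAddCommGroup E] [NormedSpace ℝ E] [FiniteDimensional ℝ E]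
  {M : Type*} [MetricSpace M] [CompactSpace M] [ChartedSpace E M] [IsManifold 𝓘(ℝ, E) ∞ M]
  [RiemannianBundle (fun x : M => TangentSpace 𝓘(ℝ, E) x)]
  [IsContMDiffRiemannianBundle 𝓘(ℝ, E) ∞ E (fun x : M => TangentSpace 𝓘(ℝ, E) x)]
  [IsRiemannianManifold 𝓘(ℝ, E) M]

-- Finitely many pairs (cut-off chart, cut-off function) are put together. The cut-off component
-- yields injectivity. The inverse is Lipschitz near the diagonal because charts have this property,
-- and away from it by compactness.
variable (E M) in
lemma exists_isGoodEmbedding_pi : ∃ (s : Finset M) (e : M → s → E × ℝ) (C : ℝ),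
    IsGoodEmbedding (E := E) e C := by
  have h1 : ∀ c : M, ∃ C : ℝ, 0 ≤ C ∧ ∃ V ∈ 𝓝 c,
      (∀ y ∈ V, ∀ z ∈ V, dist y z ≤
        C * dist (extChartAt 𝓘(ℝ, E) c y) (extChartAt 𝓘(ℝ, E) c z)) ∧
      (∀ y ∈ V, ∀ v : TangentSpace 𝓘(ℝ, E) y, ‖v‖ ≤ C * ‖tangentCoord c ⟨y, v⟩‖) := by
    intro c
    obtain ⟨C, hC, V, hV, h⟩ := exists_nhds_dist_le_extChartAt (E := E) c
    obtain ⟨D, hD⟩ := eventually_norm_tangentCoord (E := E) c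
    refine ⟨max C D, le_max_of_le_left hC, V ∩ {y | ∀ v : TangentSpace 𝓘(ℝ, E) y,
      ‖tangentCoord c ⟨y, v⟩‖ ≤ D * ‖v‖ ∧ ‖v‖ ≤ D * ‖tangentCoord c ⟨y, v⟩‖},
      inter_mem hV hD, fun y hy z hz => (h y hy.1 z hz.1).trans ?_,
      fun y hy v => (hy.2 v).2.trans ?_⟩
    · gcongr; exact le_max_left _ _
    · gcongr; exact le_max_right _ _
  choose C hC V hV hVd hVn using h1
  let ρ : ∀ c : M, SmoothBumpFunction 𝓘(ℝ, E) c := fun c => Classical.arbitrary _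
  let U : M → Set M := fun c => interior (V c ∩ {y | ρ c y = 1})
  have hU : ∀ c, c ∈ U c := fun c => mem_interior_iff_mem_nhds.2
    (inter_mem (hV c) (ρ c).eventuallyEq_one)
  have hUV : ∀ {c y}, y ∈ U c → y ∈ V c := fun h => (interior_subset h).1
  have hU1 : ∀ {c y}, y ∈ U c → ρ c y = 1 := fun h => (interior_subset h).2
  have hsrc : ∀ {c y}, ρ c y = 1 → y ∈ (chartAt E c).source := fun {c y} h =>
    (ρ c).support_subset_source (by simp [h])
  obtain ⟨s, hs⟩ := isCompact_univ.elim_finite_subcover U (fun c => isOpen_interior)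
    (fun c _ => mem_iUnion.2 ⟨c, hU c⟩)
  have hcov : ∀ y : M, ∃ c : s, y ∈ U c := fun y => by
    obtain ⟨c, hc, hy⟩ := mem_iUnion₂.1 (hs (mem_univ y))
    exact ⟨⟨c, hc⟩, hy⟩
  obtain ⟨e, he, heq, hinj⟩ : ∃ e : M → s → E × ℝ, ContMDiff 𝓘(ℝ, E) 𝓘(ℝ, s → E × ℝ) ∞ e ∧
      (∀ (c : s) y, y ∈ U c → (e y c).1 = extChartAt 𝓘(ℝ, E) (c : M) y) ∧
      ∀ x y, e x = e y → x = y := by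
    refine ⟨fun y c => (ρ c y • extChartAt 𝓘(ℝ, E) (c : M) y, ρ c y), ?_,
      fun c y hy => by simp [hU1 hy], fun x y hxy => ?_⟩
    · rw [contMDiff_pi_space]
      intro c
      refine ContMDiff.prodMk_space ?_ (ρ c).contMDiff
      exact (ρ c).contMDiff_smul contMDiffOn_extChartAt
    · obtain ⟨c, hc⟩ := hcov x
      have h1 : ρ c y = 1 := by
        rw [← hU1 hc]
        exact (congrArg (fun a => (a c).2) hxy).symm
      have h2 : extChartAt 𝓘(ℝ, E) (c : M) x = extChartAt 𝓘(ℝ, E) (c : M) y := by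
        have := congrArg (fun a => (a c).1) hxy
        simpa only [h1, hU1 hc, one_smul] using this
      refine (extChartAt 𝓘(ℝ, E) (c : M)).injOn ?_ ?_ h2 <;> rw [extChartAt_source]
      exacts [hsrc (hU1 hc), hsrc h1]
  have hsU : ∀ {c y}, y ∈ U c → y ∈ (chartAt E c).source := fun h => hsrc (hU1 h)
  have hUo : ∀ c, IsOpen (U c) := fun c => isOpen_interior
  clear_value U
  clear hsrc hU1 hU
  let D : ℝ := ∑ c : s, C c
  have hD : ∀ c : s, C c ≤ D := fun c =>
    Finset.single_le_sum (f := fun c : s => C c) (fun i _ => hC i) (Finset.mem_univ c)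
  have hD0 : 0 ≤ D := Finset.sum_nonneg fun i _ => hC i
  have hfst : ∀ (c : s) (a b : s → E × ℝ), dist (a c).1 (b c).1 ≤ dist a b := fun c a b =>
    (by rw [Prod.dist_eq]; exact le_max_left _ _ : _ ≤ dist (a c) (b c)).trans
      (dist_le_pi_dist a b c)
  -- Points at distance less than the Lebesgue number `δ` lie in a common `U c`, where the chart
  -- estimate applies.
  obtain ⟨δ, hδ, hleb⟩ := lebesgue_number_lemma_of_metric (c := fun c : s => U c) isCompact_univ
    (fun c => hUo c) (fun y _ => mem_iUnion.2 (hcov y))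
  have hK : IsCompact {p : M × M | δ ≤ dist p.1 p.2} :=
    (isClosed_le continuous_const continuous_dist).isCompact
  -- For pairs at distance at least `δ`, the quotient of the two distances is continuous on a
  -- compact set.
  obtain ⟨B, hB⟩ := hK.exists_bound_of_continuousOn
    (f := fun p : M × M => dist p.1 p.2 / dist (e p.1) (e p.2)) (by
      have := he.continuous
      refine ContinuousOn.div (by fun_prop) (by fun_prop) fun p hp h0 => ?_
      have := hinj _ _ (dist_eq_zero.1 h0)
      have hp' : δ ≤ dist p.1 p.2 := hp
      rw [this, dist_self] at hp'
      linarith)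
  refine ⟨s, e, max D B, le_max_of_le_left hD0, he, fun x y => ?_, fun X t hX hd => ?_,
    fun x v => ?_⟩
  · by_cases hxy : dist x y < δ
    · obtain ⟨c, hc⟩ := hleb x (mem_univ x)
      have hx := hc (Metric.mem_ball_self hδ)
      have hy := hc (Metric.mem_ball'.2 hxy)
      refine (hVd c x (hUV hx) y (hUV hy)).trans ?_
      rw [← heq c x hx, ← heq c y hy]
      gcongr
      · exact (hD c).trans (le_max_left _ _)
      · exact hfst c _ _
    · have h := hB (x, y) (not_lt.1 hxy)
      have hne : 0 < dist (e x) (e y) := by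
        refine dist_pos.2 fun h0 => ?_
        rw [hinj _ _ h0, dist_self] at hxy
        exact hxy hδ
      have h' := (le_abs_self _).trans h
      rw [div_le_iff₀ hne] at h'
      refine h'.trans ?_
      gcongr
      exact le_max_right _ _
  · obtain ⟨c, hc⟩ := hcov (X t)
    have hev : ∀ᶠ r in 𝓝 t, X r ∈ U c := hX ((hUo _).mem_nhds hc)
    have h1 : DifferentiableAt ℝ (fun r => (e (X r) c).1) t :=
      (differentiableAt_pi.1 hd c).fst
    -- Near `t` the curve is the inverse chart applied to a component of `e ∘ X`, and so inherits
    -- its differentiability.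
    have h2 : X =ᶠ[𝓝 t] (extChartAt 𝓘(ℝ, E) (c : M)).symm ∘ fun r => (e (X r) c).1 := by
      filter_upwards [hev] with r hr
      rw [Function.comp, heq c _ hr]
      refine ((extChartAt 𝓘(ℝ, E) (c : M)).left_inv ?_).symm
      rw [extChartAt_source]
      exact hsU hr
    refine MDifferentiableAt.congr_of_eventuallyEq ?_ h2
    have h3 := (contMDiffOn_extChartAt_symm (I := 𝓘(ℝ, E)) (n := ∞) (c : M)).mdifferentiableOn
      (by simp)
    have h4 : (e (X t) c).1 ∈ (extChartAt 𝓘(ℝ, E) (c : M)).target := by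
      rw [heq c _ hc]
      refine (extChartAt 𝓘(ℝ, E) (c : M)).map_source ?_
      rw [extChartAt_source]
      exact hsU hc
    exact ((h3 _ h4).mdifferentiableAt ((isOpen_extChartAt_target (c : M)).mem_nhds h4)).comp t
      h1.mdifferentiableAt
  · obtain ⟨c, hc⟩ := hcov x
    have hx := hsU hc
    refine (hVn c x (hUV hc) v).trans ?_
    have h1 : extChartAt 𝓘(ℝ, E) (c : M) =ᶠ[𝓝 x] (fun a : s → E × ℝ => (a c).1) ∘ e := by
      filter_upwards [(hUo _).mem_nhds hc] with y hy using (heq c _ hy).symm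
    let A : (s → E × ℝ) →L[ℝ] E :=
      (ContinuousLinearMap.fst ℝ E ℝ).comp (ContinuousLinearMap.proj c)
    have h2 : mfderiv 𝓘(ℝ, E) 𝓘(ℝ, E) (A ∘ e) x = _ :=
      mfderiv_comp x A.mdifferentiableAt (he.mdifferentiable (by simp) x)
    have h3 : tangentCoord (c : M) ⟨x, v⟩ = A (mfderiv 𝓘(ℝ, E) 𝓘(ℝ, s → E × ℝ) e x v) := by
      rw [tangentCoord_eq_mfderiv hx]
      have h4 := (h1.mfderiv_eq (I := 𝓘(ℝ, E)) (I' := 𝓘(ℝ, E))).trans h2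
      have h5 := congrArg (fun B : E →L[ℝ] E => B v) h4
      refine h5.trans ?_
      rw [mfderiv_eq_fderiv, A.fderiv]
      rfl
    rw [h3]
    have h6 : ∀ a : s → E × ℝ, ‖A a‖ ≤ ‖a‖ := fun a => by
      simpa [A] using hfst c a 0
    gcongr
    · exact (hD c).trans (le_max_left _ _)
    · exact h6 _

-- The target `Fin n → ℝ` lives in `Type`, as the test spaces in `IsPush.comp` must, and its real
-- coordinates can serve as test functions for the loop topology.
variable (E M) in
lemma exists_isGoodEmbedding : ∃ (n : ℕ) (e : M → Fin n → ℝ) (C : ℝ),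
    IsGoodEmbedding (E := E) e C := by
  obtain ⟨s, e, C, h⟩ := exists_isGoodEmbedding_pi E M
  let A : (s → E × ℝ) ≃L[ℝ] (Fin (Module.finrank ℝ (s → E × ℝ)) → ℝ) :=
    ContinuousLinearEquiv.ofFinrankEq (by simp)
  have hA : ∀ v : s → E × ℝ, ‖v‖ ≤ ‖A.symm.toContinuousLinearMap‖ * ‖A v‖ := fun v => by
    simpa using (A.symm.toContinuousLinearMap).le_opNorm (A v)
  have hm : ContMDiff 𝓘(ℝ, s → E × ℝ) 𝓘(ℝ, _) ∞ A := A.contDiff.contMDiff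
  refine ⟨_, A ∘ e, C * ‖A.symm.toContinuousLinearMap‖, mul_nonneg h.nonneg (norm_nonneg _),
    hm.comp h.contMDiff, fun x y => ?_, fun X t hX hd => h.mdifferentiableAt X t hX ?_,
    fun x v => ?_⟩
  · refine (h.dist_le x y).trans ?_
    rw [mul_assoc, dist_eq_norm, dist_eq_norm]
    have := h.nonneg
    gcongr
    simpa using hA (e x - e y)
  · have := A.symm.differentiableAt.comp t hd
    simpa [Function.comp_def] using this
  · refine (h.norm_le x v).trans ?_
    have h2 : mfderiv 𝓘(ℝ, E) 𝓘(ℝ, _) (A ∘ e) x = _ :=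
      mfderiv_comp x A.mdifferentiableAt (h.contMDiff.mdifferentiable (by simp) x)
    rw [h2, mul_assoc]
    have := h.nonneg
    gcongr
    refine (hA _).trans (le_of_eq ?_)
    rw [mfderiv_eq_fderiv, A.fderiv]
    rfl

end Embedding

/-! ### Curves in the manifold and their velocities -/

section Curves

variable {E : Type*} [NormedAddCommGroup E] [NormedSpace ℝ E]
  {M : Type*} [MetricSpace M] [ChartedSpace E M]

variable (E) in
/-- The velocity of a curve in `M`. -/
noncomputable def vel (X : ℝ → M) (t : ℝ) : TangentSpace 𝓘(ℝ, E) (X t) :=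
  mfderiv 𝓘(ℝ, ℝ) 𝓘(ℝ, E) X t (1 : ℝ)

variable (E) in
/-- The velocity curve `t ↦ (X t, X' t)` of a curve in `M`. -/
noncomputable def lift (X : ℝ → M) (t : ℝ) : TangentBundle 𝓘(ℝ, E) M :=
  ⟨X t, vel E X t⟩

/-- Stated in the total space, because the two velocities have different types. -/
lemma lift_congr {X Y : ℝ → M} {t : ℝ} (h : X =ᶠ[𝓝 t] Y) : lift E X t = lift E Y t := by
  have h2 := h.mfderiv_eq (I := 𝓘(ℝ, ℝ)) (I' := 𝓘(ℝ, E))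
  let mk : M → (ℝ →L[ℝ] E) → TangentBundle 𝓘(ℝ, E) M := fun p w => ⟨p, w 1⟩
  exact congrArg₂ mk h.eq_of_nhds h2

/-- No differentiability is needed: as `α ≠ 0`, both curves are differentiable at the corresponding
points or neither is, and in the second case both velocities are `0` by convention. -/
lemma lift_comp_affine (X : ℝ → M) {α : ℝ} (hα : α ≠ 0) (β t : ℝ) :
    lift E (fun s => X (α * s + β)) t =
      ⟨X (α * t + β), α • vel E X (α * t + β)⟩ := by
  let mk : (TangentSpace 𝓘(ℝ, E) (X (α * t + β))) → TangentBundle 𝓘(ℝ, E) M :=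
    fun w => ⟨X (α * t + β), w⟩
  refine congrArg mk (?_ : vel E (fun s => X (α * s + β)) t = α • vel E X (α * t + β))
  have hg : HasDerivAt (fun s : ℝ => α * s + β) α t := by
    simpa using ((hasDerivAt_id t).const_mul α).add_const β
  have hgm : MDifferentiableAt 𝓘(ℝ, ℝ) 𝓘(ℝ, ℝ) (fun s : ℝ => α * s + β) t :=
    hg.differentiableAt.mdifferentiableAt
  by_cases hX : MDifferentiableAt 𝓘(ℝ, ℝ) 𝓘(ℝ, E) X (α * t + β)
  · have h1 : mfderiv 𝓘(ℝ, ℝ) 𝓘(ℝ, E) (X ∘ fun s : ℝ => α * s + β) t = _ :=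
      mfderiv_comp t hX hgm
    have h2 := congrArg (fun A : ℝ →L[ℝ] E => A 1) h1
    refine h2.trans ?_
    have h3 : mfderiv 𝓘(ℝ, ℝ) 𝓘(ℝ, ℝ) (fun s : ℝ => α * s + β) t (1 : ℝ) = α • (1 : ℝ) := by
      rw [mfderiv_eq_fderiv]
      have := hg.hasFDerivAt.fderiv
      exact (congrArg (fun A : ℝ →L[ℝ] ℝ => A 1) this).trans (by simp)
    refine (congrArg (mfderiv 𝓘(ℝ, ℝ) 𝓘(ℝ, E) X (α * t + β)) h3).trans ?_
    exact map_smul (show ℝ →L[ℝ] E from mfderiv 𝓘(ℝ, ℝ) 𝓘(ℝ, E) X (α * t + β)) α (1 : ℝ)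
  · have hX' : ¬ MDifferentiableAt 𝓘(ℝ, ℝ) 𝓘(ℝ, E) (fun s => X (α * s + β)) t := by
      intro h
      refine hX ?_
      have hi : MDifferentiableAt 𝓘(ℝ, ℝ) 𝓘(ℝ, ℝ) (fun s : ℝ => α⁻¹ * (s - β)) (α * t + β) := by
        apply DifferentiableAt.mdifferentiableAt
        fun_prop
      have e1 : α⁻¹ * (α * t + β - β) = t := by field_simp; ring
      have h' : MDifferentiableAt 𝓘(ℝ, ℝ) 𝓘(ℝ, E) (fun s => X (α * s + β))
          (α⁻¹ * (α * t + β - β)) := by rwa [e1]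
      have h4 := MDifferentiableAt.comp (α * t + β) h' hi
      refine h4.congr_of_eventuallyEq (Eventually.of_forall fun s => ?_)
      simp only [Function.comp]
      congr 1
      field_simp
      ring
    have h1 : mfderiv 𝓘(ℝ, ℝ) 𝓘(ℝ, E) (fun s => X (α * s + β)) t (1 : ℝ) = (0 : E) := by
      rw [mfderiv_zero_of_not_mdifferentiableAt hX']
      rfl
    have h2 : vel E X (α * t + β) = 0 := by
      rw [vel, mfderiv_zero_of_not_mdifferentiableAt hX]
      rfl
    refine h1.trans ?_
    rw [h2]
    exact (smul_zero (A := E) α).symm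

variable [RiemannianBundle (fun x : M => TangentSpace 𝓘(ℝ, E) x)]

/-- The length of a tangent vector. -/
noncomputable def tenorm (z : TangentBundle 𝓘(ℝ, E) M) : ℝ≥0∞ := ‖z.2‖ₑ

lemma tenorm_lift (X : ℝ → M) (t : ℝ) : tenorm (lift E X t) = ‖vel E X t‖ₑ := rfl

variable (E) in
/-- A curve of class `W^{1,2}` on `[a, b]`. -/
structure SobolevOn (X : ℝ → M) (a b : ℝ) : Prop where
  ac : AbsolutelyContinuousOnInterval X a b
  lintegral_lt_top : ∫⁻ t in Ioc a b, tenorm (lift E X t) ^ 2 < ⊤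

variable {X Y : ℝ → M} {a b c : ℝ}

namespace SobolevOn

lemma continuousOn (h : SobolevOn E X a b) (hab : a ≤ b) : ContinuousOn X (Icc a b) := by
  rw [← uIcc_of_le hab]
  exact continuousOn_of_ac h.ac

lemma continuousAt (h : SobolevOn E X a b) {t : ℝ} (ht : t ∈ Ioo a b) : ContinuousAt X t :=
  (h.continuousOn (ht.1.trans ht.2).le).continuousAt (Icc_mem_nhds ht.1 ht.2)

lemma congr (h : SobolevOn E X a b) (hab : a ≤ b) (hXY : EqOn X Y (Icc a b)) :
    SobolevOn E Y a b := by
  refine ⟨absolutelyContinuousOnInterval_of_dist_le (C := 1) (fun s hs t ht => ?_) h.ac, ?_⟩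
  · rw [uIcc_of_le hab] at hs ht
    rw [hXY hs, hXY ht, one_mul]
  · refine lt_of_eq_of_lt ?_ h.lintegral_lt_top
    rw [← restrict_Ioo_eq_restrict_Ioc]
    refine setLIntegral_congr_fun measurableSet_Ioo fun t ht => ?_
    rw [lift_congr (E := E) (hXY.eventuallyEq_of_mem (Icc_mem_nhds ht.1 ht.2))]

lemma trans (h : SobolevOn E X a b) (h' : SobolevOn E X b c) (hab : a ≤ b) (hbc : b ≤ c) :
    SobolevOn E X a c := by
  refine ⟨AbsolutelyContinuousOnInterval.trans h.ac h'.ac hab hbc, ?_⟩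
  rw [← Ioc_union_Ioc_eq_Ioc hab hbc]
  exact (lintegral_union_le _ _ _).trans_lt
    (ENNReal.add_lt_top.2 ⟨h.lintegral_lt_top, h'.lintegral_lt_top⟩)

lemma comp_affine {α β : ℝ} (hα : 0 < α) (h : SobolevOn E X (α * a + β) (α * b + β))
    (hab : a ≤ b) : SobolevOn E (fun s => X (α * s + β)) a b := by
  refine ⟨AbsolutelyContinuousOnInterval.comp_monotone h.ac
    (g := fun s => α * s + β) (K := α.toNNReal)
    (fun s t hst => by dsimp only; gcongr) ?_ ?_, ?_⟩
  · refine LipschitzWith.of_dist_le_mul fun s t => ?_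
    rw [Real.dist_eq, Real.dist_eq, Real.coe_toNNReal _ hα.le, add_sub_add_right_eq_sub,
      ← mul_sub, abs_mul, abs_of_pos hα]
  · intro s hs
    rw [uIcc_of_le hab] at hs
    rw [uIcc_of_le (by gcongr)]
    exact ⟨by gcongr; exact hs.1, by gcongr; exact hs.2⟩
  · have h1 := h.lintegral_lt_top
    let g : ℝ → ℝ≥0∞ := fun t => tenorm (lift E X t) ^ 2
    have hle : ∫⁻ t in Ioc a b, tenorm (lift E (fun s => X (α * s + β)) t) ^ 2 =
        ∫⁻ t in Ioc a b, ‖α‖ₑ ^ 2 * g (α * t + β) := by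
      refine lintegral_congr fun t => ?_
      rw [lift_comp_affine X hα.ne' β t]
      rw [tenorm, enorm_smul, mul_pow]
      rfl
    have hemb : MeasurableEmbedding (fun t : ℝ => α * t + β) :=
      ((Homeomorph.mulLeft₀ α hα.ne').trans (Homeomorph.addRight β)).measurableEmbedding
    have hpre : (fun t : ℝ => α * t + β) ⁻¹' (Ioc (α * a + β) (α * b + β)) = Ioc a b := by
      ext t
      simp [hα]
    have hmap : Measure.map (fun t : ℝ => α * t + β) volume =
        ENNReal.ofReal |α⁻¹| • (volume : Measure ℝ) := by
      have : (fun t : ℝ => α * t + β) = (fun t => t + β) ∘ (fun t => α * t) := rfl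
      rw [this, ← Measure.map_map (by fun_prop) (by fun_prop), Real.map_volume_mul_left hα.ne',
        Measure.map_smul, map_add_right_eq_self]
    have hcv : ∫⁻ t in Ioc a b, g (α * t + β) =
        ENNReal.ofReal |α⁻¹| * ∫⁻ t in Ioc (α * a + β) (α * b + β), g t := by
      rw [← hpre, ← hemb.lintegral_map (μ := volume.restrict _) , ← hemb.restrict_map, hmap,
        Measure.restrict_smul, lintegral_smul_measure, smul_eq_mul]
    rw [hle, lintegral_const_mul' _ _ (by finiteness), hcv]
    exact ENNReal.mul_lt_top (by finiteness) (ENNReal.mul_lt_top (by finiteness) h1)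

end SobolevOn

end Curves

/-! ### Sobolev curves seen through smooth functions -/

section Embedding

variable {E : Type*} [NormedAddCommGroup E] [NormedSpace ℝ E]
  {M : Type*} [MetricSpace M] [CompactSpace M] [ChartedSpace E M] [IsManifold 𝓘(ℝ, E) ∞ M]
  [RiemannianBundle (fun x : M => TangentSpace 𝓘(ℝ, E) x)]
  [IsContMDiffRiemannianBundle 𝓘(ℝ, E) ∞ E (fun x : M => TangentSpace 𝓘(ℝ, E) x)]
  [IsRiemannianManifold 𝓘(ℝ, E) M]
  {F : Type*} [NormedAddCommGroup F] [NormedSpace ℝ F] [FiniteDimensional ℝ F]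
  {G : Type*} [NormedAddCommGroup G] [NormedSpace ℝ G] [FiniteDimensional ℝ G]
  {X : ℝ → M} {a b : ℝ}

lemma deriv_comp_eq {f : M → F} (hf : ContMDiff 𝓘(ℝ, E) 𝓘(ℝ, F) ∞ f) {t : ℝ}
    (hX : MDifferentiableAt 𝓘(ℝ, ℝ) 𝓘(ℝ, E) X t) :
    deriv (fun s => f (X s)) t = mfderiv 𝓘(ℝ, E) 𝓘(ℝ, F) f (X t) (vel E X t) := by
  have h1 : mfderiv 𝓘(ℝ, ℝ) 𝓘(ℝ, F) (f ∘ X) t = _ :=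
    mfderiv_comp t (hf.mdifferentiable (by simp) (X t)) hX
  have h2 := congrArg (fun A : ℝ →L[ℝ] F => A 1) h1
  rw [mfderiv_eq_fderiv] at h2
  exact (fderiv_apply_one_eq_deriv (f := f ∘ X)).symm.trans h2

lemma tangentCoord_lift {c : M} {t : ℝ} (hc : X t ∈ (chartAt E c).source)
    (hX : MDifferentiableAt 𝓘(ℝ, ℝ) 𝓘(ℝ, E) X t) :
    tangentCoord c (lift E X t) = deriv (fun s => extChartAt 𝓘(ℝ, E) c (X s)) t := by
  have h1 : mfderiv 𝓘(ℝ, ℝ) 𝓘(ℝ, E) (extChartAt 𝓘(ℝ, E) c ∘ X) t = _ :=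
    mfderiv_comp t (mdifferentiableAt_extChartAt hc) hX
  have h2 := congrArg (fun A : ℝ →L[ℝ] E => A 1) h1
  rw [mfderiv_eq_fderiv] at h2
  rw [lift, tangentCoord_eq_mfderiv hc]
  exact h2.symm.trans (fderiv_apply_one_eq_deriv (f := extChartAt 𝓘(ℝ, E) c ∘ X))

/-- With `SobolevOn.comp` this reduces the Sobolev class of curves in `M` to that of curves in a
vector space. -/
lemma IsGoodEmbedding.sobolevOn {e : M → F} {C : ℝ} (he : IsGoodEmbedding (E := E) e C)
    (hX : W12 (fun t => e (X t)) a b) : SobolevOn E X a b := by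
  have hac : AbsolutelyContinuousOnInterval X a b :=
    absolutelyContinuousOnInterval_of_dist_le (fun s _ t _ => he.dist_le (X s) (X t)) hX.ac
  refine ⟨hac, ?_⟩
  have h1 := (memLp_two_iff.1 (hX.memLp.norm.const_mul C)).2
  refine lt_of_le_of_lt (lintegral_mono_ae ?_) h1
  have h2 := hX.ae_differentiableAt
  rw [← restrict_Ioo_eq_restrict_Ioc] at h2 ⊢
  filter_upwards [h2, ae_restrict_mem measurableSet_Ioo] with t ht hab
  have hc : ContinuousAt X t := by
    refine ContinuousOn.continuousAt ?_ (Icc_mem_nhds hab.1 hab.2)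
    rw [← uIcc_of_le (hab.1.trans hab.2).le]
    exact continuousOn_of_ac hac
  have hd := he.mdifferentiableAt X t hc ht
  gcongr
  rw [tenorm_lift, ← ofReal_norm, ← ofReal_norm]
  refine ENNReal.ofReal_le_ofReal ((he.norm_le _ _).trans (le_trans (le_of_eq ?_) (le_abs_self _)))
  rw [deriv_comp_eq he.contMDiff hd]

variable [FiniteDimensional ℝ E]

namespace SobolevOn

/-- The image under a good embedding is absolutely continuous in a finite-dimensional space, hence
differentiable almost everywhere, and the embedding reflects differentiability. -/
lemma ae_mdifferentiableAt (hX : SobolevOn E X a b) :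
    ∀ᵐ t ∂volume.restrict (Ioc a b), MDifferentiableAt 𝓘(ℝ, ℝ) 𝓘(ℝ, E) X t := by
  obtain ⟨n, e, C, he⟩ := exists_isGoodEmbedding E M
  obtain ⟨K, hK⟩ := exists_lipschitzWith he.contMDiff
  have hac : AbsolutelyContinuousOnInterval (fun t => e (X t)) a b :=
    absolutelyContinuousOnInterval_of_dist_le (fun s _ t _ => hK.dist_le_mul (X s) (X t)) hX.ac
  have h2 := ae_differentiableAt_of_ac hac
  rw [← restrict_Ioo_eq_restrict_Ioc] at h2 ⊢
  filter_upwards [h2, ae_restrict_mem measurableSet_Ioo] with t ht hab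
  exact he.mdifferentiableAt X t (hX.continuousAt hab) ht

lemma comp (hX : SobolevOn E X a b) {f : M → F} (hf : ContMDiff 𝓘(ℝ, E) 𝓘(ℝ, F) ∞ f) :
    W12 (fun t => f (X t)) a b := by
  obtain ⟨K, hK⟩ := exists_lipschitzWith hf
  refine ⟨absolutelyContinuousOnInterval_of_dist_le
    (fun s _ t _ => hK.dist_le_mul (X s) (X t)) hX.ac, ?_⟩
  obtain ⟨D, hD, h⟩ := exists_norm_mfderiv_le hf
  rw [memLp_two_iff]
  refine ⟨aestronglyMeasurable_deriv_of_finiteDimensional _ _, ?_⟩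
  have h1 : ∫⁻ t in Ioc a b, ENNReal.ofReal D ^ 2 * tenorm (lift E X t) ^ 2 < ⊤ := by
    rw [lintegral_const_mul' _ _ (by finiteness)]
    exact ENNReal.mul_lt_top (by finiteness) hX.lintegral_lt_top
  refine lt_of_le_of_lt (lintegral_mono_ae ?_) h1
  filter_upwards [hX.ae_mdifferentiableAt] with t ht
  rw [← mul_pow]
  gcongr
  have h3 := h (X t) (vel E X t)
  rw [tenorm_lift, ← ofReal_norm, ← ofReal_norm, ← ENNReal.ofReal_mul hD.le, deriv_comp_eq hf ht]
  exact ENNReal.ofReal_le_ofReal (h _ _)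

end SobolevOn

end Embedding

/-! ### Straight-line motions in a chart -/

section Push

variable {E : Type*} [NormedAddCommGroup E] [NormedSpace ℝ E] [FiniteDimensional ℝ E]
  {M : Type*} [MetricSpace M] [ChartedSpace E M] [IsManifold 𝓘(ℝ, E) ∞ M]

/-- The data of a motion `z r p q`, `0 ≤ r ≤ 1`, of the points `p` close to `q` towards `q`,
taking place in a chart.  It is described by the cut-off function `χ`, the extended chart `e`
and the effect on the smooth functions on `M`. -/
structure IsPush (χ : M → ℝ) (e : M → E) (ε : ℝ) (z : ℝ → M → M → M) : Prop where
  pos : 0 < ε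
  smooth_cutoff : ContMDiff 𝓘(ℝ, E) 𝓘(ℝ, ℝ) ∞ χ
  cutoff_mem : ∀ q, χ q ∈ Icc (0 : ℝ) 1
  smooth_chart : ContMDiff 𝓘(ℝ, E) 𝓘(ℝ, E) ∞ e
  zero : ∀ p q, dist p q < ε → z 0 p q = p
  one : ∀ p q, dist p q < ε → χ q = 1 → z 1 p q = q
  diag : ∀ r p, z r p p = p
  comp : ∀ (G : Type) [NormedAddCommGroup G] [NormedSpace ℝ G] (f : M → G),
    ContMDiff 𝓘(ℝ, E) 𝓘(ℝ, G) ∞ f → ∃ (ψ : E → G) (K : NNReal), ContDiff ℝ 1 ψ ∧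
      LipschitzWith K ψ ∧ ∀ r ∈ Icc (0 : ℝ) 1, ∀ p q, dist p q < ε →
        f (z r p q) = f p - ψ (e p) + ψ (e p + r • (χ q • (e q - e p)))

/-- In the chart at `c`, the point `p` moves along the segment towards `q`, covering the fraction `r
* χ q`. Where `χ q = 0` it does not move, so nothing has to be said outside the chart. -/
lemma exists_isPush (c : M) : ∃ (χ : M → ℝ) (e : M → E) (ε : ℝ) (z : ℝ → M → M → M),
    IsPush χ e ε z ∧ {q | χ q = 1} ∈ 𝓝 c := by
  let ρ : SmoothBumpFunction 𝓘(ℝ, E) c := Classical.arbitrary _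
  have hr : 0 < ρ.rIn := ρ.rIn_pos
  -- The support of `χ` lies strictly inside the ball on which `ρ = 1`. This leaves room for a point
  -- `p` within `ε` of it, and there `e` is the true chart.
  let χ : SmoothBumpFunction 𝓘(ℝ, E) c :=
    { rIn := ρ.rIn / 4
      rOut := ρ.rIn / 2
      rIn_pos := by positivity
      rIn_lt_rOut := by linarith
      closedBall_subset := (inter_subset_inter_left _ (Metric.closedBall_subset_closedBall
        (by linarith [ρ.rIn_lt_rOut]))).trans ρ.closedBall_subset }
  have hχr : χ.rOut < ρ.rIn := by change ρ.rIn / 2 < ρ.rIn; linarith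
  set φ := extChartAt 𝓘(ℝ, E) c with hφ
  have hsrc : φ.source = (chartAt E c).source := extChartAt_source _ _
  let W : Set M := φ.source ∩ φ ⁻¹' Metric.ball (φ c) ρ.rIn
  have hWo : IsOpen W := by
    have := isOpen_extChartAt_preimage (I := 𝓘(ℝ, E)) c (Metric.isOpen_ball (x := φ c) (ε := ρ.rIn))
    rwa [← hsrc] at this
  have htW : tsupport χ ⊆ W := by
    intro q hq
    obtain ⟨w, hw, rfl⟩ := χ.tsupport_subset_symm_image_closedBall hq
    have hwt := χ.closedBall_subset hw
    refine ⟨φ.map_target hwt, ?_⟩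
    change φ (φ.symm w) ∈ Metric.ball (φ c) ρ.rIn
    rw [φ.right_inv hwt]
    exact Metric.closedBall_subset_ball hχr hw.1
  obtain ⟨ε, hε, hthick⟩ := χ.hasCompactSupport.exists_thickening_subset_open hWo htW
  have hW : ∀ p q, dist p q < ε → χ q ≠ 0 → p ∈ W ∧ q ∈ W := fun p q hpq hq => by
    have hq' : q ∈ tsupport χ := subset_tsupport _ hq
    exact ⟨hthick (Metric.mem_thickening_iff.2 ⟨q, hq', hpq⟩), htW hq'⟩
  have hρ1 : ∀ p ∈ W, ρ p = 1 := fun p hp => ρ.one_of_dist_le (hsrc ▸ hp.1) (le_of_lt hp.2)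
  let e : M → E := fun p => ρ p • φ p
  have heW : ∀ p ∈ W, e p = φ p := fun p hp => by simp [e, hρ1 p hp]
  let w : ℝ → M → M → E := fun r p q => e p + r • (χ q • (e q - e p))
  -- The case `p = q` agrees with the chart formula for nearby points (`hzeq`). It is separated to
  -- make `diag` hold by definition.
  let z : ℝ → M → M → M := fun r p q => open Classical in if χ q = 0 then p else
    if p = q then p else φ.symm (w r p q)
  have hw : ∀ r ∈ Icc (0 : ℝ) 1, ∀ p ∈ W, ∀ q ∈ W, w r p q ∈ Metric.ball (φ c) ρ.rIn := by
    intro r hr p hp q hq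
    have h1 : w r p q = AffineMap.lineMap (φ p) (φ q) (r * χ q) := by
      simp only [w, heW p hp, heW q hq, AffineMap.lineMap_apply, vsub_eq_sub, vadd_eq_add,
        smul_smul]
      rw [add_comm]
    rw [h1]
    exact (convex_ball (φ c) ρ.rIn).lineMap_mem hp.2 hq.2
      ⟨mul_nonneg hr.1 χ.nonneg, mul_le_one₀ hr.2 χ.nonneg χ.le_one⟩
  have hzeq : ∀ r p q, dist p q < ε → χ q ≠ 0 → z r p q = φ.symm (w r p q) := by
    intro r p q hpq hq
    by_cases h : p = q
    · subst h
      have hp := (hW p p hpq hq).1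
      simp only [z, hq, if_true, if_false, w, sub_self, smul_zero, add_zero, heW p hp]
      exact (φ.left_inv hp.1).symm
    · simp only [z, hq, h, if_false]
  refine ⟨χ, e, ε, z, ⟨hε, χ.contMDiff, fun q => χ.mem_Icc, ρ.contMDiff_smul contMDiffOn_extChartAt,
    fun p q hpq => ?_, fun p q hpq hq => ?_, fun r p => ?_, fun G _ _ f hf => ?_⟩,
    χ.eventuallyEq_one⟩
  · by_cases hq : χ q = 0
    · simp [z, hq]
    · rw [hzeq 0 p q hpq hq]
      have hp := (hW p q hpq hq).1
      simp only [w, zero_smul, add_zero, heW p hp]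
      exact φ.left_inv hp.1
  · have hq0 : χ q ≠ 0 := by rw [hq]; exact one_ne_zero
    rw [hzeq 1 p q hpq hq0]
    have hq' := (hW p q hpq hq0).2
    simp only [w, one_smul, hq, add_sub_cancel, heW q hq']
    exact φ.left_inv hq'.1
  · simp [z]
  -- The cut-off makes `f ∘ φ.symm` globally `C^1` with compact support, hence Lipschitz. Writing
  -- the result as `f p` plus a difference of values of `ψ` keeps the formula valid when `χ q = 0`,
  -- wherever `p` is.
  · let ψ : E → G := fun v => ρ.toContDiffBump v • f (φ.symm v)
    have hψ : ContDiff ℝ 1 ψ := by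
      refine contDiff_iff_contDiffAt.2 fun v => ?_
      by_cases hv : v ∈ tsupport ρ.toContDiffBump
      · have hvt : v ∈ φ.target := by
          refine ρ.closedBall_subset ⟨?_, by simp⟩
          rwa [ρ.toContDiffBump.tsupport_eq] at hv
        refine ρ.toContDiffBump.contDiff.contDiffAt.smul ?_
        rw [← contMDiffAt_iff_contDiffAt]
        have h1 : ContMDiffAt 𝓘(ℝ, E) 𝓘(ℝ, E) 1 φ.symm v :=
          (contMDiffOn_extChartAt_symm c).contMDiffAt
            ((isOpen_extChartAt_target c).mem_nhds hvt)
        exact (hf.of_le (by simp)).contMDiffAt.comp v h1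
      · have h1 : ψ =ᶠ[𝓝 v] fun _ => 0 := by
          filter_upwards [notMem_tsupport_iff_eventuallyEq.1 hv] with u hu
          simp only [ψ, smul_eq_zero]
          exact Or.inl hu
        exact contDiffAt_const.congr_of_eventuallyEq h1
    have hcs : HasCompactSupport ψ := ρ.toContDiffBump.hasCompactSupport.smul_right
    obtain ⟨K, hK⟩ := hψ.lipschitzWith_of_hasCompactSupport hcs one_ne_zero
    have hψe : ∀ v ∈ Metric.ball (φ c) ρ.rIn, ψ v = f (φ.symm v) := fun v hv => by
      simp only [ψ]
      rw [ρ.toContDiffBump.one_of_mem_closedBall (Metric.ball_subset_closedBall hv), one_smul]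
    refine ⟨ψ, K, hψ, hK, fun r hr p q hpq => ?_⟩
    by_cases hq : χ q = 0
    · simp [z, hq]
    · obtain ⟨hp', hq'⟩ := hW p q hpq hq
      rw [hzeq r p q hpq hq]
      have h1 : ψ (e p + r • (χ q • (e q - e p))) = f (φ.symm (w r p q)) :=
        hψe _ (hw r hr p hp' q hq')
      have h2 : ψ (e p) = f p := by
        rw [heW p hp', hψe _ hp'.2]
        exact congrArg f (φ.left_inv hp'.1)
      rw [h1, h2]
      simp

end Push

/-! ### Chart motions applied to maps and to Sobolev loops -/

section LoopSpace

variable {E : Type*} [NormedAddCommGroup E] [NormedSpace ℝ E] [FiniteDimensional ℝ E]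
  {M : Type*} [MetricSpace M] [CompactSpace M] [ChartedSpace E M] [IsManifold 𝓘(ℝ, E) ∞ M]
  [RiemannianBundle (fun x : M => TangentSpace 𝓘(ℝ, E) x)]
  [IsContMDiffRiemannianBundle 𝓘(ℝ, E) ∞ E (fun x : M => TangentSpace 𝓘(ℝ, E) x)]
  [IsRiemannianManifold 𝓘(ℝ, E) M]

lemma IsGoodEmbedding.isInducing {F : Type*} [NormedAddCommGroup F] [NormedSpace ℝ F]
    {e : M → F} {C : ℝ} (he : IsGoodEmbedding (E := E) e C) : IsInducing e := by
  obtain ⟨K, hK⟩ := exists_lipschitzWith he.contMDiff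
  refine (AntilipschitzWith.isUniformInducing (K := C.toNNReal) ?_ hK.uniformContinuous).isInducing
  refine AntilipschitzWith.of_le_mul_dist fun x y => ?_
  rw [Real.coe_toNNReal _ he.nonneg]
  exact he.dist_le x y

variable {χ : M → ℝ} {e : M → E} {ε : ℝ} {z : ℝ → M → M → M}

/-- A motion increases the distance to the target by at most a bounded factor, so finitely many
motions can be performed in succession. -/
lemma IsPush.exists_dist_le (hz : IsPush χ e ε z) : ∃ C : ℝ, 0 < C ∧
    ∀ r ∈ Icc (0 : ℝ) 1, ∀ p q, dist p q < ε → dist (z r p q) q ≤ C * dist p q := by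
  obtain ⟨n, f, C, hf⟩ := exists_isGoodEmbedding E M
  obtain ⟨ψ, K, -, hK, h⟩ := hz.comp _ f hf.contMDiff
  obtain ⟨D, hD⟩ := exists_lipschitzWith hz.smooth_chart
  have hC := hf.nonneg
  refine ⟨C * (K * D) + 1, by positivity, fun r hr p q hpq => ?_⟩
  have h1 : dist (z r p q) p ≤ C * (K * D) * dist p q := by
    refine (hf.dist_le _ _).trans ?_
    rw [h r hr p q hpq, dist_eq_norm, mul_assoc]
    gcongr
    have h2 : f p - ψ (e p) + ψ (e p + r • (χ q • (e q - e p))) - f p =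
      ψ (e p + r • (χ q • (e q - e p))) - ψ (e p) := by abel
    rw [h2, ← dist_eq_norm]
    refine (hK.dist_le_mul _ _).trans ?_
    rw [mul_assoc]
    gcongr
    rw [dist_eq_norm, add_sub_cancel_left, norm_smul, norm_smul, Real.norm_of_nonneg hr.1,
      Real.norm_of_nonneg (hz.cutoff_mem q).1]
    have h3 := hD.dist_le_mul p q
    rw [dist_eq_norm, norm_sub_rev] at h3
    refine le_trans ?_ h3
    have h4 : χ q * ‖e q - e p‖ ≤ 1 * ‖e q - e p‖ := by
      gcongr; exact (hz.cutoff_mem q).2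
    have h5 : 0 ≤ χ q * ‖e q - e p‖ := mul_nonneg (hz.cutoff_mem q).1 (norm_nonneg _)
    calc r * (χ q * ‖e q - e p‖) ≤ 1 * (χ q * ‖e q - e p‖) := by gcongr; exact hr.2
      _ ≤ ‖e q - e p‖ := by linarith
  calc dist (z r p q) q ≤ dist (z r p q) p + dist p q := dist_triangle _ _ _
    _ ≤ (C * (K * D) + 1) * dist p q := by linarith

lemma IsPush.continuous (hz : IsPush χ e ε z) {X : Type*} [TopologicalSpace X] {f g : X → M}
    (hf : Continuous f) (hg : Continuous g) (hfg : ∀ x, dist (f x) (g x) < ε) :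
    Continuous fun p : unitInterval × X => z p.1 (f p.2) (g p.2) := by
  obtain ⟨n, i, C, hi⟩ := exists_isGoodEmbedding E M
  obtain ⟨ψ, K, hψ, -, h⟩ := hz.comp _ i hi.contMDiff
  rw [hi.isInducing.continuous_iff]
  have h1 : (i ∘ fun p : unitInterval × X => z p.1 (f p.2) (g p.2)) = fun p =>
      i (f p.2) - ψ (e (f p.2)) +
        ψ (e (f p.2) + (p.1 : ℝ) • (χ (g p.2) • (e (g p.2) - e (f p.2)))) := by
    funext p
    exact h p.1 p.1.2 _ _ (hfg p.2)
  rw [h1]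
  have c1 := hi.contMDiff.continuous
  have c2 := hψ.continuous
  have c3 := hz.smooth_chart.continuous
  have c4 := hz.smooth_cutoff.continuous
  fun_prop

/-- Points already on target stay fixed by `diag`. Applied to paths, this keeps the common endpoints
in place. -/
lemma IsPush.homotopicRel (hz : IsPush χ e ε z) {X : Type*} [TopologicalSpace X] {f g : C(X, M)}
    (hfg : ∀ x, dist (f x) (g x) < ε) : ∃ f' : C(X, M), (∀ x, f' x = z 1 (f x) (g x)) ∧
      f.HomotopicRel f' {x | f x = g x} := by
  have hc := hz.continuous f.continuous g.continuous hfg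
  refine ⟨⟨fun x => z 1 (f x) (g x), ?_⟩, fun x => rfl, ⟨⟨⟨⟨_, hc⟩, fun x => ?_, fun x => rfl⟩,
    fun t x hx => ?_⟩⟩⟩
  · exact hc.comp (Continuous.prodMk_right (1 : unitInterval))
  · exact hz.zero _ _ (hfg x)
  · have hx' : f x = g x := hx
    change z t (f x) (g x) = f x
    rw [← hx', hz.diag]

lemma SobolevLoop.sobolevOn (x : SobolevLoop E M) : SobolevOn E (fun s : ℝ => x.1 s) 0 1 :=
  ⟨x.2.1, x.2.2⟩

lemma isSobolevLoop_of_sobolevOn {x : C(UnitAddCircle, M)}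
    (h : SobolevOn E (fun s : ℝ => x s) 0 1) : IsSobolevLoop E x :=
  ⟨h.ac, h.lintegral_lt_top⟩

lemma sobolevDist_triangle {u v w : UnitAddCircle → ℝ} (hu : Continuous u) (hv : Continuous v)
    (hw : Continuous w) : sobolevDist u w ≤ sobolevDist u v + sobolevDist v w := by
  have hc : Continuous fun s : ℝ => (s : UnitAddCircle) := AddCircle.continuous_mk' 1
  have hm : ∀ {u : UnitAddCircle → ℝ}, Continuous u →
      AEStronglyMeasurable (fun s : ℝ => u s) (volume.restrict (Ioc 0 1)) := fun hu =>
    (hu.comp hc).aestronglyMeasurable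
  have hd : ∀ u : UnitAddCircle → ℝ, AEStronglyMeasurable (deriv fun r : ℝ => u r)
      (volume.restrict (Ioc (0 : ℝ) 1)) :=
    fun u => aestronglyMeasurable_deriv_of_finiteDimensional _ _
  unfold sobolevDist
  have h1 := eLpNorm_add_le (p := 2) ((hm hu).sub (hm hv)) ((hm hv).sub (hm hw)) (by norm_num)
  have h2 := eLpNorm_add_le (p := 2) ((hd u).sub (hd v)) ((hd v).sub (hd w)) (by norm_num)
  rw [sub_add_sub_cancel] at h1 h2
  refine (add_le_add h1 h2).trans (le_of_eq ?_)
  exact add_add_add_comm _ _ _ _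

/-- Tested against a smooth function, the moving loop is a fixed Lipschitz function of an affine
family in `r`, to which `tendsto_comp_affine` applies. -/
lemma IsPush.joined (hz : IsPush χ e ε z) {x y : SobolevLoop E M}
    (hxy : ∀ t, dist (x.1 t) (y.1 t) < ε) : ∃ x' : SobolevLoop E M,
      (∀ t, x'.1 t = z 1 (x.1 t) (y.1 t)) ∧ Joined x x' := by
  have hc := hz.continuous x.1.continuous y.1.continuous hxy
  have hw : W12 (fun s : ℝ => e (x.1 s)) 0 1 := x.sobolevOn.comp hz.smooth_chart
  have hk : W12 (fun s : ℝ => χ (y.1 s) • (e (y.1 s) - e (x.1 s))) 0 1 :=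
    (y.sobolevOn.comp hz.smooth_cutoff).smul ((y.sobolevOn.comp hz.smooth_chart).sub hw)
  have hs : ∀ r : unitInterval, SobolevOn E (fun s : ℝ => z r (x.1 s) (y.1 s)) 0 1 := by
    intro r
    obtain ⟨n, i, C, hi⟩ := exists_isGoodEmbedding E M
    obtain ⟨ψ, K, hψ, hK, h⟩ := hz.comp _ i hi.contMDiff
    refine hi.sobolevOn ?_
    have hd := hψ.differentiable one_ne_zero
    have h1 := ((x.sobolevOn.comp hi.contMDiff).sub (hw.comp hK hd)).add
      ((hw.add (hk.const_smul r)).comp hK hd)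
    refine h1.congr (fun s _ => ?_) zero_le_one
    exact (h r r.2 _ _ (hxy s)).symm
  let γ : unitInterval → SobolevLoop E M := fun r =>
    ⟨⟨fun t => z r (x.1 t) (y.1 t), hc.comp (Continuous.prodMk_right r)⟩,
      isSobolevLoop_of_sobolevOn (hs r)⟩
  have hγ : Continuous γ := by
    refine continuous_generateFrom_iff.2 ?_
    rintro U ⟨f, x₀, δ, rfl⟩
    rw [isOpen_iff_mem_nhds]
    intro r₀ hr₀
    obtain ⟨ψ, K, hψ, hK, h⟩ := hz.comp ℝ f f.contMDiff
    have hc := (x.sobolevOn.comp f.contMDiff).sub (hw.comp hK (hψ.differentiable one_ne_zero))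
    have ht := (tendsto_comp_affine hc hw hk hK hψ r₀).comp
      (continuous_subtype_val.tendsto r₀)
    have heq : ∀ r : unitInterval, (fun s : ℝ => f ((γ r).1 s)) = fun s : ℝ =>
        f (x.1 s) - ψ (e (x.1 s)) +
          ψ (e (x.1 s) + (r : ℝ) • (χ (y.1 s) • (e (y.1 s) - e (x.1 s)))) := fun r =>
      funext fun s => h r r.2 _ _ (hxy s)
    have ht' : Tendsto (fun r => sobolevDist (fun t => f ((γ r₀).1 t)) (fun t => f ((γ r).1 t)))
        (𝓝 r₀) (𝓝 0) := by
      refine ht.congr fun r => ?_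
      simp only [sobolevDist, Function.comp]
      rw [heq r, heq r₀]
      congr 2
      funext s
      rw [← congrFun (heq r) s, ← congrFun (heq r₀) s]
    have hr₀' : sobolevDist (fun t => f (x₀.1 t)) (fun t => f ((γ r₀).1 t)) < δ := hr₀
    -- The subbasic ball need not be centred at `γ r₀`, so the triangle inequality is used to pass
    -- to its centre `x₀`.
    have ht'' : Tendsto (fun r => sobolevDist (fun t => f (x₀.1 t)) (fun t => f ((γ r₀).1 t)) +
        sobolevDist (fun t => f ((γ r₀).1 t)) (fun t => f ((γ r).1 t))) (𝓝 r₀)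
        (𝓝 (sobolevDist (fun t => f (x₀.1 t)) (fun t => f ((γ r₀).1 t)) + 0)) :=
      ht'.const_add _
    rw [add_zero] at ht''
    filter_upwards [ht''.eventually_lt_const hr₀'] with r hr
    refine lt_of_le_of_lt (sobolevDist_triangle ?_ ?_ ?_) hr
    · exact f.contMDiff.continuous.comp x₀.1.continuous
    · exact f.contMDiff.continuous.comp (γ r₀).1.continuous
    · exact f.contMDiff.continuous.comp (γ r).1.continuous
  refine ⟨γ 1, fun t => rfl, ⟨⟨⟨γ, hγ⟩, ?_, rfl⟩⟩⟩
  exact Subtype.ext (ContinuousMap.ext fun t => hz.zero _ _ (hxy t))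

end LoopSpace

/-! ### Close maps are homotopic, and approximation by Sobolev curves -/

section Components

variable {E : Type*} [NormedAddCommGroup E] [NormedSpace ℝ E] [FiniteDimensional ℝ E]
  {M : Type*} [MetricSpace M] [CompactSpace M] [ChartedSpace E M] [IsManifold 𝓘(ℝ, E) ∞ M]
  [RiemannianBundle (fun x : M => TangentSpace 𝓘(ℝ, E) x)]
  [IsContMDiffRiemannianBundle 𝓘(ℝ, E) ∞ E (fun x : M => TangentSpace 𝓘(ℝ, E) x)]
  [IsRiemannianManifold 𝓘(ℝ, E) M]

variable (E) in
/-- If maps into `M` can be moved along chart motions, then a map which is close to another one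
can be moved onto it. -/
lemma exists_pos_of_isPush {X A : Type*} (ev : A → X → M) (R : A → A → A → Prop)
    (refl : ∀ g f, R g f f)
    (trans : ∀ g f f₁ f₂, (∀ x, ev f x = ev g x → ev f₁ x = ev g x) → R g f f₁ → R g f₁ f₂ →
      R g f f₂)
    (push : ∀ (χ : M → ℝ) (e : M → E) ε z, IsPush χ e ε z → ∀ f g,
      (∀ x, dist (ev f x) (ev g x) < ε) →
        ∃ f', (∀ x, ev f' x = z 1 (ev f x) (ev g x)) ∧ R g f f') :
    ∃ ε > 0, ∀ f g, (∀ x, dist (ev f x) (ev g x) < ε) →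
      ∃ f', (∀ x, ev f' x = ev g x) ∧ R g f f' := by
  choose χ e ε z hz hmem using exists_isPush (E := E) (M := M)
  obtain ⟨s, -, hs⟩ := isCompact_univ.elim_nhds_subcover (fun c => {q | χ c q = 1})
    (fun c _ => hmem c)
  -- Induction over charts: after the motions in `s`, every point with some `χ c = 1` has reached
  -- its target, and points on target remain there. The threshold `δ` is chosen backwards, so that
  -- the next motion still starts within its own `ε c`.
  have key : ∀ s : Finset M, ∀ η > 0, ∃ δ > 0, ∀ f g, (∀ x, dist (ev f x) (ev g x) < δ) →
      ∃ f', (∀ x, dist (ev f' x) (ev g x) < η) ∧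
        (∀ x, (∃ c ∈ s, χ c (ev g x) = 1) ∨ ev f x = ev g x → ev f' x = ev g x) ∧
        R g f f' := by
    classical
    intro s
    induction s using Finset.induction_on with
    | empty =>
      intro η hη
      refine ⟨η, hη, fun f g h => ⟨f, h, fun x hx => ?_, refl g f⟩⟩
      simpa using hx
    | insert c s _ ih =>
      intro η hη
      obtain ⟨C, hC, hCz⟩ := (hz c).exists_dist_le
      obtain ⟨δ, hδ, h⟩ := ih (min (ε c) (η / C)) (lt_min (hz c).pos (by positivity))
      refine ⟨δ, hδ, fun f g hfg => ?_⟩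
      obtain ⟨f₁, h1, h2, h3⟩ := h f g hfg
      have h1' : ∀ x, dist (ev f₁ x) (ev g x) < ε c := fun x => (h1 x).trans_le (min_le_left _ _)
      obtain ⟨f₂, h4, h5⟩ := push _ _ _ _ (hz c) f₁ g h1'
      refine ⟨f₂, fun x => ?_, fun x hx => ?_, trans g f f₁ f₂ (fun x hx => h2 x (Or.inr hx)) h3 h5⟩
      · rw [h4]
        refine (hCz 1 (by simp) _ _ (h1' x)).trans_lt ?_
        have := (h1 x).trans_le (min_le_right _ _)
        rwa [lt_div_iff₀' hC] at this
      · rw [h4]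
        by_cases h6 : ev f₁ x = ev g x
        · rw [h6, (hz c).diag]
        · refine (hz c).one _ _ (h1' x) ?_
          by_contra h7
          refine h6 (h2 x ?_)
          rcases hx with ⟨d, hd, hdx⟩ | hx
          · rcases Finset.mem_insert.1 hd with rfl | hd
            · exact absurd hdx h7
            · exact Or.inl ⟨d, hd, hdx⟩
          · exact Or.inr hx
  obtain ⟨δ, hδ, h⟩ := key s 1 one_pos
  refine ⟨δ, hδ, fun f g hfg => ?_⟩
  obtain ⟨f', -, h2, h3⟩ := h f g hfg
  refine ⟨f', fun x => h2 x (Or.inl ?_), h3⟩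
  obtain ⟨c, hc, hx⟩ := mem_iUnion₂.1 (hs (mem_univ (ev g x)))
  exact ⟨c, hc, hx⟩

lemma homotopicRel_mono {X Y : Type*} [TopologicalSpace X] [TopologicalSpace Y] {f g : C(X, Y)}
    {S T : Set X} (h : f.HomotopicRel g S) (hTS : T ⊆ S) : f.HomotopicRel g T :=
  h.map fun H => ⟨H.toHomotopy, fun t x hx => H.prop' t x (hTS hx)⟩

lemma exists_pos_homotopicRel (E : Type*) [NormedAddCommGroup E] [NormedSpace ℝ E]
    [FiniteDimensional ℝ E] (M : Type*) [MetricSpace M] [CompactSpace M] [ChartedSpace E M]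
    [IsManifold 𝓘(ℝ, E) ∞ M] [RiemannianBundle (fun x : M => TangentSpace 𝓘(ℝ, E) x)]
    [IsContMDiffRiemannianBundle 𝓘(ℝ, E) ∞ E (fun x : M => TangentSpace 𝓘(ℝ, E) x)]
    [IsRiemannianManifold 𝓘(ℝ, E) M] (X : Type*) [TopologicalSpace X] :
    ∃ ε > 0, ∀ f g : C(X, M),
      (∀ x, dist (f x) (g x) < ε) → f.HomotopicRel g {x | f x = g x} := by
  obtain ⟨ε, hε, h⟩ := exists_pos_of_isPush E (M := M) (A := C(X, M)) (fun f x => f x)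
    (fun g f f' => f.HomotopicRel f' {x | f x = g x}) (fun g f => .refl f)
    (fun g f f₁ f₂ h h1 h2 => h1.trans (homotopicRel_mono h2 h))
    (fun χ e ε z hz f g hfg => hz.homotopicRel hfg)
  refine ⟨ε, hε, fun f g hfg => ?_⟩
  obtain ⟨f', h1, h2⟩ := h f g hfg
  rwa [ContinuousMap.ext h1] at h2

variable (E M) in
lemma exists_pos_joined : ∃ ε > 0, ∀ x y : SobolevLoop E M,
    (∀ t, dist (x.1 t) (y.1 t) < ε) → Joined x y := by
  obtain ⟨ε, hε, h⟩ := exists_pos_of_isPush E (M := M) (A := SobolevLoop E M) (fun f x => f.1 x)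
    (fun g f f' => Joined f f') (fun g f => .refl f)
    (fun g f f₁ f₂ _ h1 h2 => h1.trans h2)
    (fun χ e ε z hz f g hfg => hz.joined hfg)
  refine ⟨ε, hε, fun f g hfg => ?_⟩
  obtain ⟨f', h1, h2⟩ := h f g hfg
  rwa [show f' = g from Subtype.ext (ContinuousMap.ext h1)] at h2

/-- The `W^{1,2}` topology is finer than the uniform one, by the Sobolev inequality for each
coordinate of an embedding. -/
lemma SobolevLoop.nhds_of_pos (x : SobolevLoop E M) {ε : ℝ} (hε : 0 < ε) :
    {y : SobolevLoop E M | ∀ t, dist (x.1 t) (y.1 t) < ε} ∈ 𝓝 x := by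
  obtain ⟨n, e, C, he⟩ := exists_isGoodEmbedding E M
  have hC := he.nonneg
  have hej : ∀ j, ContMDiff 𝓘(ℝ, E) 𝓘(ℝ, ℝ) ∞ fun p => e p j := fun j =>
    contMDiff_pi_space.1 he.contMDiff j
  let f : Fin n → C^∞⟮𝓘(ℝ, E), M; ℝ⟯ := fun j => ⟨fun p => e p j, hej j⟩
  let δ : ℝ := ε / (C + 1)
  have hδ : 0 < δ := by positivity
  have h1 : ∀ j, {y : SobolevLoop E M | sobolevDist (fun t => f j (x.1 t)) (fun t => f j (y.1 t)) <
      ENNReal.ofReal δ} ∈ 𝓝 x := by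
    intro j
    refine IsOpen.mem_nhds (TopologicalSpace.isOpen_generateFrom_of_mem ⟨f j, x, _, rfl⟩) ?_
    simp [sobolevDist, hδ]
  filter_upwards [Filter.iInter_mem.2 h1] with y hy t
  obtain ⟨s, hs, rfl⟩ : ∃ s ∈ Icc (0 : ℝ) 1, (s : UnitAddCircle) = t := by
    obtain ⟨s, hs, rfl⟩ := AddCircle.coe_image_Icc_eq (1 : ℝ) 0 ▸ mem_univ t
    exact ⟨s, by simpa using hs, rfl⟩
  have h2 : dist (e (x.1 s)) (e (y.1 s)) ≤ δ := by
    rw [dist_pi_le_iff hδ.le]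
    intro j
    have h3 : sobolevDist (fun t => f j (x.1 t)) (fun t => f j (y.1 t)) < ENNReal.ofReal δ :=
      mem_iInter.1 hy j
    have hx := x.sobolevOn.comp (hej j)
    have hy := y.sobolevOn.comp (hej j)
    have h4 := (hx.sub hy).enorm_le hs
    have h5 : eLpNorm (deriv fun s : ℝ => e (x.1 s) j - e (y.1 s) j) 2
        (volume.restrict (Ioc 0 1)) = eLpNorm (fun s : ℝ => deriv (fun s : ℝ => e (x.1 s) j) s -
          deriv (fun s : ℝ => e (y.1 s) j) s) 2 (volume.restrict (Ioc 0 1)) := by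
      refine eLpNorm_congr_ae ?_
      filter_upwards [hx.ae_differentiableAt, hy.ae_differentiableAt] with s h1 h2
      exact (h1.hasDerivAt.sub h2.hasDerivAt).deriv
    rw [h5] at h4
    have h6 := h4.trans_lt h3
    rw [← ofReal_norm, ENNReal.ofReal_lt_ofReal_iff hδ] at h6
    exact h6.le
  refine (he.dist_le _ _).trans_lt ?_
  calc C * dist (e (x.1 s)) (e (y.1 s)) ≤ C * δ := by gcongr
    _ < (C + 1) * δ := by gcongr; linarith
    _ = ε := by simp only [δ]; field_simp

/-- Since nearby loops are homotopic, a free homotopy class is open and so is its complement. -/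
lemma homotopic_of_mem_connectedComponent {x y : SobolevLoop E M}
    (h : y ∈ connectedComponent x) : x.1.Homotopic y.1 := by
  obtain ⟨ε, hε, hh⟩ := exists_pos_homotopicRel E M UnitAddCircle
  have hnear : ∀ y : SobolevLoop E M, ∀ᶠ y' in 𝓝 y, y.1.Homotopic y'.1 := fun y => by
    filter_upwards [y.nhds_of_pos hε] with y' hy' using (hh _ _ hy').homotopic
  have hcl : IsClopen {y : SobolevLoop E M | x.1.Homotopic y.1} := by
    refine ⟨⟨?_⟩, ?_⟩
    · rw [isOpen_iff_mem_nhds]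
      intro y hy
      filter_upwards [hnear y] with y' hy' h' using hy (h'.trans hy'.symm)
    · rw [isOpen_iff_mem_nhds]
      intro y hy
      filter_upwards [hnear y] with y' hy' using hy.trans hy'
  exact hcl.connectedComponent_subset (x := x) (ContinuousMap.Homotopic.refl _) h

lemma W12.of_contDiffOn {F : Type*} [NormedAddCommGroup F] [NormedSpace ℝ F]
    [FiniteDimensional ℝ F] {u : ℝ → F} {U : Set ℝ} (hU : IsOpen U) (hu : ContDiffOn ℝ 1 u U)
    {a b : ℝ} (hab : a ≤ b) (h : Icc a b ⊆ U) : W12 u a b := by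
  refine ⟨(hu.mono (by rwa [uIcc_of_le hab])).absolutelyContinuousOnInterval, ?_⟩
  have hc : ContinuousOn (deriv u) (Icc a b) := (hu.continuousOn_deriv_of_isOpen hU le_rfl).mono h
  obtain ⟨C, hC⟩ := isCompact_Icc.exists_bound_of_continuousOn hc
  refine (memLp_const C).of_le (aestronglyMeasurable_deriv_of_finiteDimensional _ _) ?_
  filter_upwards [ae_restrict_mem measurableSet_Ioc] with t ht
  exact (hC t (Ioc_subset_Icc_self ht)).trans (le_abs_self C)

variable (E) in
/-- A continuous curve can be approximated by curves in `W^{1,2}` with the same endpoints. -/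
lemma exists_sobolevOn_near {f : ℝ → M} (hf : Continuous f) {a b : ℝ} (hab : a ≤ b) {ε : ℝ}
    (hε : 0 < ε) : ∃ X : ℝ → M, SobolevOn E X a b ∧ X a = f a ∧ X b = f b ∧
      ∀ t ∈ Icc a b, dist (X t) (f t) < ε := by
  let P : ℝ → ℝ → Prop := fun a b => ∃ X : ℝ → M, SobolevOn E X a b ∧ X a = f a ∧ X b = f b ∧
      ∀ t ∈ Icc a b, dist (X t) (f t) < ε
  -- On a short interval `f` stays in a small chart ball, and the coordinate segment joining its end
  -- values is the approximation.
  have hloc : ∀ t₀ : ℝ, ∃ N : Set ℝ, IsOpen N ∧ t₀ ∈ N ∧ ∀ a b, a ≤ b → Icc a b ⊆ N → P a b := by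
    intro t₀
    set c := f t₀
    set φ := extChartAt 𝓘(ℝ, E) c with hφ
    obtain ⟨r, hr, hball⟩ : ∃ r > 0, Metric.ball (φ c) r ⊆ φ.target ∩
        φ.symm ⁻¹' Metric.ball c (ε / 2) := by
      refine Metric.mem_nhds_iff.1 (inter_mem (extChartAt_target_mem_nhds c) ?_)
      refine (continuousAt_extChartAt_symm c).preimage_mem_nhds ?_
      rw [← hφ, φ.left_inv (mem_extChartAt_source c)]
      exact Metric.ball_mem_nhds _ (by positivity)
    have hN : f ⁻¹' (φ.source ∩ φ ⁻¹' Metric.ball (φ c) r ∩ Metric.ball c (ε / 2)) ∈ 𝓝 t₀ :=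
      hf.continuousAt.preimage_mem_nhds (inter_mem (inter_mem (extChartAt_source_mem_nhds c)
        ((continuousAt_extChartAt c).preimage_mem_nhds (Metric.ball_mem_nhds _ hr)))
        (Metric.ball_mem_nhds _ (by positivity)))
    obtain ⟨N, hNs, hNo, ht₀⟩ := mem_nhds_iff.1 hN
    refine ⟨N, hNo, ht₀, fun a b hab hsub => ?_⟩
    have ha := hNs (hsub (left_mem_Icc.2 hab))
    have hb := hNs (hsub (right_mem_Icc.2 hab))
    -- If `a = b` the quotient is `0` by convention, and the curve is constant.
    let η : ℝ → E := fun t => AffineMap.lineMap (φ (f a)) (φ (f b)) ((t - a) / (b - a))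
    have hηs : ContDiff ℝ 1 η := by
      have h1 := (ContinuousAffineMap.lineMap (R := ℝ) (φ (f a)) (φ (f b))).contDiff (n := 1)
      rw [ContinuousAffineMap.coe_lineMap_eq] at h1
      exact h1.comp ((contDiff_id.sub contDiff_const).div_const _)
    have hη : ∀ t ∈ Icc a b, η t ∈ Metric.ball (φ c) r := fun t ht =>
      (convex_ball (φ c) r).lineMap_mem ha.1.2 hb.1.2
        ⟨div_nonneg (by linarith [ht.1]) (by linarith),
          div_le_one_of_le₀ (by linarith [ht.2]) (by linarith)⟩
    refine ⟨fun t => φ.symm (η t), ?_, ?_, ?_, fun t ht => ?_⟩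
    · obtain ⟨n, e, C, he⟩ := exists_isGoodEmbedding E M
      refine he.sobolevOn (W12.of_contDiffOn (U := η ⁻¹' Metric.ball (φ c) r)
        (Metric.isOpen_ball.preimage hηs.continuous) ?_ hab hη)
      have h1 : ContDiffOn ℝ 1 (e ∘ φ.symm) (Metric.ball (φ c) r) := by
        rw [← contMDiffOn_iff_contDiffOn]
        exact (he.contMDiff.of_le (by simp)).comp_contMDiffOn
          ((contMDiffOn_extChartAt_symm c).mono fun v hv => (hball hv).1)
      exact h1.comp hηs.contDiffOn fun t ht => ht
    · simp only [η, sub_self, zero_div, AffineMap.lineMap_apply_zero]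
      exact φ.left_inv ha.1.1
    · rcases hab.eq_or_lt with rfl | hab'
      · simp only [η, sub_self, zero_div, AffineMap.lineMap_apply_zero]
        exact φ.left_inv ha.1.1
      · simp only [η, div_self (sub_pos.2 hab').ne', AffineMap.lineMap_apply_one]
        exact φ.left_inv hb.1.1
    · have h1 := Metric.mem_ball.1 (hball (hη t ht)).2
      have h2 := Metric.mem_ball'.1 (hNs (hsub ht)).2
      calc dist (φ.symm (η t)) (f t) ≤ dist (φ.symm (η t)) c + dist c (f t) := dist_triangle _ _ _
        _ < ε := by linarith
  have htrans : ∀ x y z, x ≤ y → y ≤ z → P x y → P y z → P x z := by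
    rintro x y z hxy hyz ⟨X, hX, hXx, hXy, hXd⟩ ⟨Y, hY, hYy, hYz, hYd⟩
    let Z : ℝ → M := fun t => if t ≤ y then X t else Y t
    have hZX : EqOn X Z (Icc x y) := fun t ht => by simp [Z, ht.2]
    have hZY : EqOn Y Z (Icc y z) := fun t ht => by
      rcases ht.1.eq_or_lt with rfl | h
      · simp [Z, hXy, hYy]
      · simp [Z, not_le.2 h]
    refine ⟨Z, (hX.congr hxy hZX).trans (hY.congr hyz hZY) hxy hyz, ?_, ?_, fun t ht => ?_⟩
    · rw [← hZX (left_mem_Icc.2 hxy), hXx]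
    · rw [← hZY (right_mem_Icc.2 hyz), hYz]
    · rcases le_total t y with h | h
      · rw [← hZX ⟨ht.1, h⟩]; exact hXd t ⟨ht.1, h⟩
      · rw [← hZY ⟨h, ht.2⟩]; exact hYd t ⟨h, ht.2⟩
  choose N hNo hNm hNP using hloc
  obtain ⟨t, ht0, htm, ⟨m, htm'⟩, htN⟩ := exists_monotone_Icc_subset_open_cover_Icc hab
    (c := fun t₀ : ℝ => Subtype.val ⁻¹' N t₀) (fun s => (hNo s).preimage continuous_subtype_val)
    (fun s _ => mem_iUnion.2 ⟨s, hNm s⟩)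
  have hind : ∀ k, P a (t k) := by
    intro k
    induction k with
    | zero =>
      rw [ht0]
      exact hNP a a a le_rfl (by simpa using hNm a)
    | succ k ih =>
      obtain ⟨i, hi⟩ := htN k
      have hk : (t k : ℝ) ≤ t (k + 1) := htm (Nat.le_succ k)
      exact htrans _ _ _ (t k).2.1 hk ih (hNP i _ _ hk fun s hs => hi (show (⟨s, (t k).2.1.trans hs.1,
        hs.2.trans (t (k + 1)).2.2⟩ : Icc a b) ∈ Icc (t k) (t (k + 1)) from hs))
  have := hind m
  rwa [htm' m le_rfl] at this

end Components

/-! ### From closed curves to maps on the circle -/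

section Loop

variable {M : Type*} [TopologicalSpace M]

lemma circle_coe_one : ((1 : ℝ) : UnitAddCircle) = ((0 : ℝ) : UnitAddCircle) := by
  simp

/-- The loop obtained from a curve defined on `[0, 1]` with equal endpoints. -/
noncomputable def circleMap {X : ℝ → M} (hX : ContinuousOn X (Icc 0 1)) (h : X 0 = X 1) :
    C(UnitAddCircle, M) :=
  ⟨AddCircle.liftIco 1 0 X, AddCircle.liftIco_zero_continuous h hX⟩

lemma circleMap_apply {X : ℝ → M} (hX : ContinuousOn X (Icc 0 1)) (h : X 0 = X 1) {s : ℝ}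
    (hs : s ∈ Icc (0 : ℝ) 1) : circleMap hX h (s : UnitAddCircle) = X s := by
  rcases hs.2.eq_or_lt with rfl | hs'
  · rw [circle_coe_one, ← h]
    exact AddCircle.liftIco_zero_coe_apply ⟨le_rfl, one_pos⟩
  · exact AddCircle.liftIco_zero_coe_apply ⟨hs.1, hs'⟩

end Loop

/-! ### Free homotopy classes are path connected in the loop space -/

section Components

variable {E : Type*} [NormedAddCommGroup E] [NormedSpace ℝ E] [FiniteDimensional ℝ E]
  {M : Type*} [MetricSpace M] [CompactSpace M] [ChartedSpace E M] [IsManifold 𝓘(ℝ, E) ∞ M]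
  [RiemannianBundle (fun x : M => TangentSpace 𝓘(ℝ, E) x)]
  [IsContMDiffRiemannianBundle 𝓘(ℝ, E) ∞ E (fun x : M => TangentSpace 𝓘(ℝ, E) x)]
  [IsRiemannianManifold 𝓘(ℝ, E) M]

/-- The loop of class `W^{1,2}` obtained from a closed curve of class `W^{1,2}` on `[0, 1]`. -/
noncomputable def SobolevOn.loop {X : ℝ → M} (hX : SobolevOn E X 0 1) (h : X 0 = X 1) :
    SobolevLoop E M :=
  ⟨circleMap (hX.continuousOn zero_le_one) h, isSobolevLoop_of_sobolevOn
    (hX.congr zero_le_one fun _ hs => (circleMap_apply _ h hs).symm)⟩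

lemma SobolevOn.loop_apply {X : ℝ → M} (hX : SobolevOn E X 0 1) (h : X 0 = X 1) {s : ℝ}
    (hs : s ∈ Icc (0 : ℝ) 1) : (hX.loop h).1 (s : UnitAddCircle) = X s :=
  circleMap_apply (hX.continuousOn zero_le_one) h hs

lemma exists_coe_eq (t : UnitAddCircle) : ∃ s ∈ Icc (0 : ℝ) 1, (s : UnitAddCircle) = t := by
  obtain ⟨s, hs, rfl⟩ := AddCircle.coe_image_Icc_eq (1 : ℝ) 0 ▸ mem_univ t
  exact ⟨s, by simpa using hs, rfl⟩

variable (E) in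
lemma exists_sobolevLoop_near (f : C(UnitAddCircle, M)) {ε : ℝ} (hε : 0 < ε) :
    ∃ y : SobolevLoop E M, ∀ t, dist (y.1 t) (f t) < ε := by
  obtain ⟨X, hX, h0, h1, hd⟩ := exists_sobolevOn_near E (f := fun s : ℝ => f s)
    (f.continuous.comp (AddCircle.continuous_mk' 1)) zero_le_one hε
  have h01 : X 0 = X 1 := by
    rw [h0, h1]
    exact congrArg f circle_coe_one.symm
  refine ⟨hX.loop h01, fun t => ?_⟩
  obtain ⟨s, hs, rfl⟩ := exists_coe_eq t
  rw [hX.loop_apply h01 hs]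
  exact hd s hs

/-- Homotopic loops of class `W^{1,2}` are homotopic within the space of such loops. -/
lemma joined_of_homotopic {x y : SobolevLoop E M} (h : x.1.Homotopic y.1) : Joined x y := by
  obtain ⟨H⟩ := h
  obtain ⟨ε, hε, hj⟩ := exists_pos_joined E M
  let c : C(unitInterval, C(UnitAddCircle, M)) := H.toContinuousMap.curry
  have hc : ∀ r t, c r t = H (r, t) := fun r t => rfl
  -- The intermediate loops of the homotopy are merely continuous, so each is represented by all
  -- Sobolev loops close to it. The set `S` of good times is open and closed and contains `0`.
  let S : Set unitInterval := {r | ∀ z : SobolevLoop E M, (∀ t, dist (z.1 t) (c r t) < ε / 4) →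
    Joined x z}
  have hstep : ∀ r r', dist (c r) (c r') < ε / 4 → r ∈ S → r' ∈ S := by
    intro r r' hrr' hr z hz
    obtain ⟨w, hw⟩ := exists_sobolevLoop_near E (c r) (ε := ε / 4) (by positivity)
    refine (hr w hw).trans (hj w z fun t => ?_)
    have h1 := (ContinuousMap.dist_apply_le_dist (f := c r) (g := c r') t).trans_lt hrr'
    have h2 := hw t
    have h3 := dist_comm (z.1 t) (c r' t) ▸ hz t
    calc dist (w.1 t) (z.1 t) ≤ dist (w.1 t) (c r t) + dist (c r t) (c r' t) +
          dist (c r' t) (z.1 t) := dist_triangle4 _ _ _ _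
      _ < ε := by linarith
  have hnear : ∀ r, ∀ᶠ r' in 𝓝 r, dist (c r) (c r') < ε / 4 := fun r => by
    have := c.continuous.continuousAt (x := r) (Metric.ball_mem_nhds (c r)
      (by positivity : 0 < ε / 4))
    filter_upwards [this] with r' hr' using Metric.mem_ball'.1 hr'
  have hcl : IsClopen S := by
    refine ⟨⟨?_⟩, ?_⟩
    · rw [isOpen_iff_mem_nhds]
      intro r hr
      filter_upwards [hnear r] with r' hr' h' using hr (hstep r' r (dist_comm (c r) _ ▸ hr') h')
    · rw [isOpen_iff_mem_nhds]
      intro r hr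
      filter_upwards [hnear r] with r' hr' using hstep r r' hr' hr
  have h0 : (0 : unitInterval) ∈ S := fun z hz => hj x z fun t => by
    have h1 := hz t
    rw [hc, H.apply_zero, dist_comm] at h1
    linarith
  have h1 : (1 : unitInterval) ∈ S := by
    rw [hcl.eq_univ ⟨0, h0⟩]
    exact mem_univ _
  refine h1 y fun t => ?_
  rw [hc, H.apply_one, dist_self]
  positivity

end Components

/-! ### Lower and quadratic upper bounds for the Lagrangian -/

section Lagrangian

variable {E : Type*} [NormedAddCommGroup E] [NormedSpace ℝ E] [FiniteDimensional ℝ E]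
  {M : Type*} [TopologicalSpace M] [ChartedSpace E M] [IsManifold 𝓘(ℝ, E) ∞ M]

/-- A function on the tangent bundle written in the trivialization at `c`. -/
noncomputable def localRep (L : TangentBundle 𝓘(ℝ, E) M → ℝ) (c : M) (p : M × E) : ℝ :=
  L ((trivializationAt E (TangentSpace 𝓘(ℝ, E)) c).toOpenPartialHomeomorph.symm p)

lemma continuousOn_localRep {L : TangentBundle 𝓘(ℝ, E) M → ℝ} (hL : Continuous L) (c : M) :
    ContinuousOn (localRep L c) ((chartAt E c).source ×ˢ univ) := by
  refine hL.comp_continuousOn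
    (((trivializationAt E (TangentSpace 𝓘(ℝ, E)) c).toOpenPartialHomeomorph).continuousOn_symm.mono
      ?_)
  intro p hp
  rw [Trivialization.target_eq]
  exact ⟨by simpa using hp.1, mem_univ _⟩

lemma continuousAt_localRep {L : TangentBundle 𝓘(ℝ, E) M → ℝ} (hL : Continuous L) (c : M)
    (w : E) : ContinuousAt (localRep L c) (c, w) :=
  (continuousOn_localRep hL c).continuousAt
    (((chartAt E c).open_source.prod isOpen_univ).mem_nhds ⟨mem_chart_source E c, mem_univ _⟩)

lemma localRep_tangentCoord (L : TangentBundle 𝓘(ℝ, E) M → ℝ) {c : M}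
    {z : TangentBundle 𝓘(ℝ, E) M} (hz : z.1 ∈ (chartAt E c).source) :
    localRep L c (z.1, tangentCoord c z) = L z := by
  have hz' : z ∈ (trivializationAt E (TangentSpace 𝓘(ℝ, E)) c).source := by
    rw [Trivialization.mem_source]
    simpa using hz
  have h1 : (z.1, tangentCoord c z) =
      (trivializationAt E (TangentSpace 𝓘(ℝ, E)) c).toOpenPartialHomeomorph z := by
    refine Prod.ext ?_ rfl
    exact ((trivializationAt E (TangentSpace 𝓘(ℝ, E)) c).coe_fst hz').symm
  rw [localRep, h1]
  exact congrArg L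
    ((trivializationAt E (TangentSpace 𝓘(ℝ, E)) c).toOpenPartialHomeomorph.left_inv hz')

/-- The tangent vector with given coordinates in the trivialization at `c`. -/
noncomputable def ofCoord (c y : M) : E →L[ℝ] TangentSpace 𝓘(ℝ, E) y :=
  (trivializationAt E (TangentSpace 𝓘(ℝ, E)) c).symmL ℝ y

lemma localRep_eq (L : TangentBundle 𝓘(ℝ, E) M → ℝ) {c y : M}
    (hy : y ∈ (chartAt E c).source) (w : E) : localRep L c (y, w) = L ⟨y, ofCoord c y w⟩ := by
  have hb : y ∈ (trivializationAt E (TangentSpace 𝓘(ℝ, E)) c).baseSet := by simpa using hy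
  have h1 : ofCoord c y w = (trivializationAt E (TangentSpace 𝓘(ℝ, E)) c).symm y w :=
    Trivialization.symmL_apply _ hb w
  rw [h1]
  exact congrArg L (Trivialization.mk_symm _ hb w).symm

lemma tangentCoord_ofCoord {c y : M} (hy : y ∈ (chartAt E c).source) (w : E) :
    tangentCoord c ⟨y, ofCoord c y w⟩ = w := by
  have hb : y ∈ (trivializationAt E (TangentSpace 𝓘(ℝ, E)) c).baseSet := by simpa using hy
  have h1 : ofCoord c y w = (trivializationAt E (TangentSpace 𝓘(ℝ, E)) c).symm y w :=
    Trivialization.symmL_apply _ hb w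
  rw [h1]
  have := Trivialization.apply_mk_symm (trivializationAt E (TangentSpace 𝓘(ℝ, E)) c) hb w
  exact congrArg Prod.snd this

variable [RiemannianBundle (fun x : M => TangentSpace 𝓘(ℝ, E) x)]
  [IsContMDiffRiemannianBundle 𝓘(ℝ, E) ∞ E (fun x : M => TangentSpace 𝓘(ℝ, E) x)]

/-- The three coefficients are linear combinations of the values at `s = 1, 2, 3`, hence bounded by
multiples of `B`. Completing the square gives the lower bound. The numerical constants are not
sharp. -/
lemma quadratic_bounds {a b V l₁ l₂ l₃ B m : ℝ} (h1 : l₁ = a + b - V) (h2 : l₂ = 4 * a + 2 * b - V)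
    (h3 : l₃ = 9 * a + 3 * b - V) (hB1 : |l₁| ≤ B) (hB2 : |l₂| ≤ B) (hB3 : |l₃| ≤ B)
    (hm : 0 < m) (hma : m ≤ a) {s : ℝ} (hs : 1 ≤ s) :
    |a * s ^ 2 + b * s - V| ≤ 21 * B * (1 + s ^ 2) ∧
      -(21 * B + 16 * B ^ 2 / m) ≤ a * s ^ 2 + b * s - V := by
  rw [abs_le] at hB1 hB2 hB3
  have ha : a ≤ 2 * B := by linarith
  have hb : b ≤ 8 * B := by linarith
  have hb' : -(8 * B) ≤ b := by linarith
  have hV : V ≤ 11 * B := by linarith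
  have hV' : -(11 * B) ≤ V := by linarith
  have hB : 0 ≤ B := by linarith
  have k1 : a * s ^ 2 ≤ 2 * B * s ^ 2 := by gcongr
  have k2 : m * s ^ 2 ≤ a * s ^ 2 := by gcongr
  have k3 : b * s ≤ 8 * B * s := by gcongr
  have k4 : -(8 * B) * s ≤ b * s := by gcongr
  have k5 : 8 * B * s ≤ 4 * B * (1 + s ^ 2) := by nlinarith [sq_nonneg (s - 1)]
  have k6 : 0 ≤ B * s ^ 2 := by positivity
  have k7 : 0 ≤ m * s ^ 2 := by positivity
  refine ⟨abs_le.2 ⟨by linarith, by linarith⟩, ?_⟩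
  have k8 : 0 ≤ m * s ^ 2 - 8 * B * s + 16 * B ^ 2 / m := by
    have : m * s ^ 2 - 8 * B * s + 16 * B ^ 2 / m = (m * s - 4 * B) ^ 2 / m := by
      field_simp; ring
    rw [this]; positivity
  linarith

/-- Along rays far from the origin `L` is a quadratic polynomial, and its coefficients can be read
off from `L` on a compact set. Continuity of `L` thus bounds them uniformly near `c`, without
estimating `h`, `θ` and `V` separately. -/
lemma exists_bounds_near {L : TangentBundle 𝓘(ℝ, E) M → ℝ} (hL : Continuous L)
    (hL' : IsElectromagneticAtInfinity L) (c : M) :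
    ∃ K : ℝ, ∀ᶠ y in 𝓝 c, 0 ≤ K ∧ ∀ v : TangentSpace 𝓘(ℝ, E) y,
      |L ⟨y, v⟩| ≤ K * (1 + ‖v‖ ^ 2) ∧ -K ≤ L ⟨y, v⟩ := by
  obtain ⟨h, θ, V, R, hLR⟩ := hL'
  obtain ⟨C, hC⟩ := eventually_norm_tangentCoord (E := E) c
  have hsrc := (chartAt E c).open_source.mem_nhds (mem_chart_source E c)
  set C' := max C 1 with hC'
  have hC'1 : 1 ≤ C' := le_max_right _ _
  -- Near `c`, a vector whose coordinates have norm at least `ρ` has Riemannian norm at least `|R| +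
  -- 1`, so the electromagnetic formula applies to it.
  set ρ := C' * (|R| + 1) with hρ
  have hρ0 : 0 < ρ := by positivity
  -- Behaviour of `L` along rays
  have hray : ∀ᶠ y in 𝓝 c, ∀ u : E, ‖u‖ = ρ → ∃ a b V' : ℝ, 0 < a ∧ ∀ s : ℝ, 1 ≤ s →
      localRep L c (y, s • u) = a * s ^ 2 + b * s - V' := by
    filter_upwards [hC, hsrc] with y hy hys u hu
    have hcoord := tangentCoord_ofCoord hys
    refine ⟨1 / 2 * h.inner y (ofCoord c y u) (ofCoord c y u), θ y (ofCoord c y u), V y, ?_,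
      fun s hs => ?_⟩
    · refine mul_pos (by norm_num) (h.pos y _ fun h0 => ?_)
      have h1 := hcoord u
      have h2 := (hy (ofCoord c y u)).1
      rw [h0, norm_zero, mul_zero, ← h0, h1, hu] at h2
      linarith
    · have h1 : R ≤ ‖ofCoord c y (s • u)‖ := by
        have h2 := (hy (ofCoord c y (s • u))).1
        rw [hcoord, norm_smul, hu, Real.norm_of_nonneg (by linarith)] at h2
        have h3 : C * ‖ofCoord c y (s • u)‖ ≤ C' * ‖ofCoord c y (s • u)‖ := by
          gcongr; exact le_max_left _ _
        have h4 : 1 * ρ ≤ s * ρ := by gcongr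
        have h5 : C' * (|R| + 1) ≤ C' * ‖ofCoord c y (s • u)‖ := by linarith
        have h6 := le_of_mul_le_mul_left h5 (by linarith)
        linarith [le_abs_self R]
      rw [localRep_eq L hys, hLR y _ h1, map_smul]
      have e1 : h.inner y (s • ofCoord c y u) (s • ofCoord c y u) =
          s ^ 2 * h.inner y (ofCoord c y u) (ofCoord c y u) := by
        rw [map_smul, map_smul]
        simp only [_root_.smul_apply, smul_eq_mul]
        ring
      have e2 : (θ y (s • ofCoord c y u) : ℝ) = s * θ y (ofCoord c y u) := by
        rw [map_smul]; rfl
      rw [e1, e2]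
      ring
  have hbd : ∃ B : ℝ, ∀ᶠ y in 𝓝 c, ∀ w ∈ Metric.closedBall (0 : E) (3 * ρ),
      |localRep L c (y, w)| ≤ B := by
    obtain ⟨B, hB⟩ := (isCompact_closedBall (0 : E) (3 * ρ)).exists_bound_of_continuousOn
      (f := fun w => localRep L c (c, w)) fun w _ =>
        ((continuousAt_localRep hL c w).comp (by fun_prop : ContinuousAt (fun w : E => (c, w)) w)
          ).continuousWithinAt
    refine ⟨B + 1, (isCompact_closedBall (0 : E) (3 * ρ)).eventually_forall_of_forall_eventually
      (P := fun y w => |localRep L c (y, w)| ≤ B + 1) fun w hw => ?_⟩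
    have h1 := (continuousAt_localRep hL c w).abs
    exact h1.eventually_le_const (lt_of_le_of_lt (hB w hw) (lt_add_one B))
  obtain ⟨B, hB⟩ := hbd
  -- The second difference of `L` along a ray recovers its leading coefficient. It is positive on
  -- the compact sphere over `c`, so it stays above `m / 2` nearby.
  let q : M × E → ℝ := fun p => (localRep L c (p.1, (3 : ℝ) • p.2) -
    2 * localRep L c (p.1, (2 : ℝ) • p.2) + localRep L c (p.1, p.2)) / 2
  have hqc : ∀ w, ContinuousAt q (c, w) := by
    intro w
    have h1 : ∀ r : ℝ, ContinuousAt (fun p : M × E => localRep L c (p.1, r • p.2)) (c, w) :=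
      fun r => ContinuousAt.comp (x := (c, w)) (g := localRep L c)
        (f := fun p : M × E => (p.1, r • p.2))
        (continuousAt_localRep hL c (r • w)) (by fun_prop)
    exact (((h1 3).sub ((h1 2).const_mul 2)).add (continuousAt_localRep hL c w)).div_const 2
  have hqa : ∀ {y : M} {u : E} {a b V' : ℝ}, (∀ s : ℝ, 1 ≤ s →
      localRep L c (y, s • u) = a * s ^ 2 + b * s - V') → q (y, u) = a := by
    intro y u a b V' h
    have h1 := h 1 le_rfl
    rw [one_smul] at h1
    simp only [q, h 3 (by norm_num), h 2 (by norm_num), h1]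
    ring
  obtain ⟨m, hm, hqm⟩ : ∃ m > 0, ∀ u ∈ Metric.sphere (0 : E) ρ, m ≤ q (c, u) := by
    refine (isCompact_sphere (0 : E) ρ).exists_forall_le' (f := fun u => q (c, u)) (fun w _ =>
      ((hqc w).comp (by fun_prop : ContinuousAt (fun w : E => (c, w)) w)).continuousWithinAt) ?_
    intro u hu
    obtain ⟨a, b, V', ha, hs⟩ := hray.self_of_nhds u (by simpa using hu)
    rw [hqa hs]
    exact ha
  have hqm' : ∀ᶠ y in 𝓝 c, ∀ u ∈ Metric.sphere (0 : E) ρ, m / 2 ≤ q (y, u) := by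
    refine (isCompact_sphere (0 : E) ρ).eventually_forall_of_forall_eventually
      (P := fun y u => m / 2 ≤ q (y, u)) fun u hu => ?_
    exact (hqc u).eventually_const_le (lt_of_lt_of_le (by linarith) (hqm u hu))
  refine ⟨21 * B + 16 * B ^ 2 / (m / 2), ?_⟩
  filter_upwards [hray, hB, hqm', hC, hsrc] with y hy1 hy2 hy3 hy4 hys
  have hB0 : 0 ≤ B := (abs_nonneg _).trans (hy2 0 (by simp; positivity))
  refine ⟨by positivity, fun v => ?_⟩
  set w := tangentCoord c ⟨y, v⟩ with hw
  rw [← localRep_tangentCoord L (c := c) (z := ⟨y, v⟩) hys]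
  change |localRep L c (y, w)| ≤ _ ∧ _ ≤ localRep L c (y, w)
  have hK : B ≤ 21 * B + 16 * B ^ 2 / (m / 2) := by
    have : 0 ≤ 16 * B ^ 2 / (m / 2) := by positivity
    linarith
  rcases le_total ‖w‖ ρ with hwρ | hwρ
  · have h1 := hy2 w (by simp; linarith)
    constructor
    · refine (h1.trans hK).trans ?_
      have : 0 ≤ (21 * B + 16 * B ^ 2 / (m / 2)) * ‖v‖ ^ 2 := by positivity
      linarith
    · have := (abs_le.1 h1).1
      linarith
  · set s := ‖w‖ / ρ with hs
    have hs1 : 1 ≤ s := (one_le_div hρ0).2 hwρ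
    set u := s⁻¹ • w with hu
    have hsu : s • u = w := by rw [hu, smul_smul, mul_inv_cancel₀ (by positivity), one_smul]
    have hun : ‖u‖ = ρ := by
      rw [hu, norm_smul, norm_inv, Real.norm_of_nonneg (by positivity), hs]
      have : 0 < ‖w‖ := hρ0.trans_le hwρ
      field_simp
    obtain ⟨a, b, V', -, hray⟩ := hy1 u hun
    have hball : ∀ r : ℝ, 0 ≤ r → r ≤ 3 → r • u ∈ Metric.closedBall (0 : E) (3 * ρ) :=
      fun r h0 h3 => by
        rw [mem_closedBall_zero_iff, norm_smul, hun, Real.norm_of_nonneg h0]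
        gcongr
    have hq := hy3 u (by simpa using hun)
    rw [hqa hray] at hq
    obtain ⟨k1, k2⟩ := quadratic_bounds (B := B) (m := m / 2)
      (by rw [hray 1 le_rfl]; ring : localRep L c (y, (1 : ℝ) • u) = a + b - V')
      (by rw [hray 2 (by norm_num)]; ring : localRep L c (y, (2 : ℝ) • u) = 4 * a + 2 * b - V')
      (by rw [hray 3 (by norm_num)]; ring : localRep L c (y, (3 : ℝ) • u) = 9 * a + 3 * b - V')
      (hy2 _ (hball 1 (by norm_num) (by norm_num))) (hy2 _ (hball 2 (by norm_num) (by norm_num)))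
      (hy2 _ (hball 3 (by norm_num) (by norm_num))) (by positivity) hq hs1
    rw [← hray s hs1, hsu] at k1 k2
    refine ⟨k1.trans ?_, k2⟩
    have hsv : s ≤ ‖v‖ := by
      rw [hs, div_le_iff₀ hρ0]
      have h1 := (hy4 v).1
      calc ‖w‖ ≤ C * ‖v‖ := h1
        _ ≤ C' * ‖v‖ := by gcongr; exact le_max_left _ _
        _ ≤ ‖v‖ * ρ := by
          rw [hρ, mul_comm ‖v‖]
          gcongr
          nlinarith [abs_nonneg R]
    have : 0 ≤ 16 * B ^ 2 / (m / 2) := by positivity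
    gcongr
    linarith

lemma exists_bounds [CompactSpace M] {L : TangentBundle 𝓘(ℝ, E) M → ℝ} (hL : Continuous L)
    (hL' : IsElectromagneticAtInfinity L) : ∃ K : ℝ, 0 < K ∧ ∀ (y : M)
      (v : TangentSpace 𝓘(ℝ, E) y), |L ⟨y, v⟩| ≤ K * (1 + ‖v‖ ^ 2) ∧ -K ≤ L ⟨y, v⟩ := by
  obtain ⟨K, hK0, hK⟩ := exists_bound_of_locally (p := fun y K => 0 ≤ K ∧
    ∀ v : TangentSpace 𝓘(ℝ, E) y, |L ⟨y, v⟩| ≤ K * (1 + ‖v‖ ^ 2) ∧ -K ≤ L ⟨y, v⟩)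
    (fun x K K' hKK' h => ⟨h.1.trans hKK', fun v => ⟨(h.2 v).1.trans (by gcongr),
      le_trans (by linarith) (h.2 v).2⟩⟩) (exists_bounds_near hL hL')
  exact ⟨K, hK0, fun y => (hK y).2⟩

end Lagrangian

/-! ### The action of a curve -/

section Action

variable {E : Type*} [NormedAddCommGroup E] [NormedSpace ℝ E]
  {M : Type*} [MetricSpace M] [ChartedSpace E M]
  {L : TangentBundle 𝓘(ℝ, E) M → ℝ} {κ a b : ℝ} {X Y : ℝ → M}

lemma lift_comp_affine_of_eq (X : ℝ → M) {α : ℝ} (hα : α ≠ 0) {β t r : ℝ} (hr : r = α * t + β) :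
    lift E (fun s => X (α * s + β)) t = ⟨X r, α • vel E X r⟩ := by
  subst hr
  exact lift_comp_affine X hα β t

/-- The action of a curve `X` on `[a, b]`. -/
noncomputable def curveAction (L : TangentBundle 𝓘(ℝ, E) M → ℝ) (κ : ℝ) (X : ℝ → M) (a b : ℝ) :
    ℝ :=
  ∫ t in a..b, (L (lift E X t) + κ)

lemma curveAction_congr (hab : a ≤ b) (hXY : EqOn X Y (Icc a b)) :
    curveAction L κ X a b = curveAction L κ Y a b := by
  rw [curveAction, curveAction, intervalIntegral.integral_of_le hab,
    intervalIntegral.integral_of_le hab, integral_Ioc_eq_integral_Ioo,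
    integral_Ioc_eq_integral_Ioo]
  refine setIntegral_congr_fun measurableSet_Ioo fun t ht => ?_
  rw [lift_congr (hXY.eventuallyEq_of_mem (Icc_mem_nhds ht.1 ht.2))]

lemma curveAction_comp_sub (T : ℝ) :
    curveAction L κ (fun t => X (t - T)) (a + T) (b + T) = curveAction L κ X a b := by
  have h : ∀ t, lift E (fun t => X (t - T)) t = lift E X (t - T) := fun t => by
    have := lift_comp_affine_of_eq (E := E) X one_ne_zero (β := -T) (t := t) (r := t - T) (by ring)
    simp only [one_mul, one_smul, ← sub_eq_add_neg] at this
    exact this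
  simp only [curveAction, h]
  rw [intervalIntegral.integral_comp_sub_right (fun t => L (lift E X t) + κ)]
  simp

end Action

/-! ### Integrability of the Lagrangian along curves, and concatenation -/

section Integrability

variable {E : Type*} [NormedAddCommGroup E] [NormedSpace ℝ E] [FiniteDimensional ℝ E]
  {M : Type*} [MetricSpace M] [CompactSpace M] [ChartedSpace E M] [IsManifold 𝓘(ℝ, E) ∞ M]
  [RiemannianBundle (fun x : M => TangentSpace 𝓘(ℝ, E) x)]
  [IsContMDiffRiemannianBundle 𝓘(ℝ, E) ∞ E (fun x : M => TangentSpace 𝓘(ℝ, E) x)]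
  [IsRiemannianManifold 𝓘(ℝ, E) M]
  {L : TangentBundle 𝓘(ℝ, E) M → ℝ} {κ a b c : ℝ} {X Y : ℝ → M}

/-- Countably many charts cover `M`. Over each of them the integrand agrees almost everywhere with a
Borel function of the position and of the derivative in coordinates. -/
lemma SobolevOn.aestronglyMeasurable (hL : Continuous L) (hX : SobolevOn E X a b)
    (hab : a ≤ b) :
    AEStronglyMeasurable (fun t => L (lift E X t)) (volume.restrict (Ioo a b)) := by
  have hc : ContinuousOn X (Ioo a b) := (hX.continuousOn hab).mono Ioo_subset_Icc_self
  obtain ⟨s, hs, hcov⟩ := TopologicalSpace.countable_cover_nhds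
    (f := fun c : M => (chartAt E c).source)
    (fun c => (chartAt E c).open_source.mem_nhds (mem_chart_source E c))
  have hcount := hs.to_subtype
  have hU : Ioo a b = ⋃ c : s, Ioo a b ∩ X ⁻¹' (chartAt E (c : M)).source := by
    rw [← inter_iUnion, ← preimage_iUnion, iUnion_subtype, hcov, preimage_univ, inter_univ]
  rw [hU, aestronglyMeasurable_iUnion_iff]
  rintro ⟨c, -⟩
  set O := Ioo a b ∩ X ⁻¹' (chartAt E c).source with hO
  have hOo : IsOpen O := hc.isOpen_inter_preimage isOpen_Ioo (chartAt E c).open_source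
  borelize M E
  have : ProperSpace E := FiniteDimensional.proper ℝ E
  have : CompleteSpace E := FiniteDimensional.complete ℝ E
  have h1 : AEMeasurable (fun t => (X t, deriv (fun s => extChartAt 𝓘(ℝ, E) c (X s)) t))
      (volume.restrict O) :=
    ((hc.mono inter_subset_left).aemeasurable hOo.measurableSet).prodMk
      (measurable_deriv _).aemeasurable
  classical
  have h2 : Measurable (((chartAt E c).source ×ˢ (univ : Set E)).piecewise (localRep L c) 0) :=
    (continuousOn_localRep hL c).measurable_piecewise continuousOn_const
      ((chartAt E c).open_source.prod isOpen_univ).measurableSet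
  refine (h2.comp_aemeasurable h1).aestronglyMeasurable.congr ?_
  have h3 := hX.ae_mdifferentiableAt
  rw [← restrict_Ioo_eq_restrict_Ioc] at h3
  filter_upwards [ae_mono (Measure.restrict_mono inter_subset_left le_rfl) h3,
    ae_restrict_mem hOo.measurableSet] with t ht htO
  have h4 : (X t, deriv (fun s => extChartAt 𝓘(ℝ, E) c (X s)) t) ∈
      (chartAt E c).source ×ˢ (univ : Set E) := ⟨htO.2, mem_univ _⟩
  rw [Function.comp_apply, piecewise_eq_of_mem _ _ _ h4, ← tangentCoord_lift htO.2 ht]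
  exact localRep_tangentCoord L (z := lift E X t) htO.2

/-- `L` grows at most quadratically and the velocity is square integrable. -/
lemma SobolevOn.intervalIntegrable (hL : Continuous L) (hL' : IsElectromagneticAtInfinity L)
    (hX : SobolevOn E X a b) (hab : a ≤ b) :
    IntervalIntegrable (fun t => L (lift E X t) + κ) volume a b := by
  rw [intervalIntegrable_iff_integrableOn_Ioc_of_le hab]
  refine Integrable.add ?_ (integrableOn_const (by simp))
  refine ⟨restrict_Ioo_eq_restrict_Ioc (μ := volume) (a := a) (b := b) ▸
    hX.aestronglyMeasurable hL hab, ?_⟩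
  obtain ⟨K, hK, h⟩ := exists_bounds hL hL'
  have h1 : ∫⁻ t in Ioc a b,
      (ENNReal.ofReal K + ENNReal.ofReal K * tenorm (lift E X t) ^ 2) < ⊤ := by
    rw [lintegral_add_left measurable_const, lintegral_const_mul' _ _ (by finiteness)]
    refine ENNReal.add_lt_top.2 ⟨?_, ENNReal.mul_lt_top (by finiteness) hX.lintegral_lt_top⟩
    rw [setLIntegral_const]
    exact ENNReal.mul_lt_top (by finiteness) (by simp)
  refine lt_of_le_of_lt (lintegral_mono fun t => ?_) h1
  have h2 := (h (X t) (vel E X t)).1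
  rw [tenorm_lift, ← ofReal_norm, ← ofReal_norm, ← ENNReal.ofReal_pow (norm_nonneg _),
    ← ENNReal.ofReal_mul hK.le, ← ENNReal.ofReal_add hK.le (by positivity)]
  refine ENNReal.ofReal_le_ofReal (le_trans h2 (le_of_eq ?_))
  ring

lemma curveAction_add (hL : Continuous L) (hL' : IsElectromagneticAtInfinity L)
    (hX : SobolevOn E X a b) (hX' : SobolevOn E X b c) (hab : a ≤ b) (hbc : b ≤ c) :
    curveAction L κ X a b + curveAction L κ X b c = curveAction L κ X a c :=
  intervalIntegral.integral_add_adjacent_intervals (hX.intervalIntegrable hL hL' hab)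
    (hX'.intervalIntegrable hL hL' hbc)

lemma curveAction_eq_add (hL : Continuous L) (hL' : IsElectromagneticAtInfinity L)
    (hX : SobolevOn E X a b) (hab : a ≤ b) :
    curveAction L κ X a b = curveAction L 0 X a b + κ * (b - a) := by
  have h := hX.intervalIntegrable (κ := 0) hL hL' hab
  simp only [add_zero] at h
  simp only [curveAction, add_zero]
  rw [intervalIntegral.integral_add h intervalIntegrable_const,
    intervalIntegral.integral_const, smul_eq_mul, mul_comm]

lemma le_curveAction (hL : Continuous L) (hL' : IsElectromagneticAtInfinity L) {m : ℝ}
    (hm : ∀ (y : M) (v : TangentSpace 𝓘(ℝ, E) y), m ≤ L ⟨y, v⟩)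
    (hX : SobolevOn E X a b) (hab : a ≤ b) : (m + κ) * (b - a) ≤ curveAction L κ X a b := by
  have h1 : ∫ t in a..b, (m + κ) ≤ curveAction L κ X a b :=
    intervalIntegral.integral_mono_on hab intervalIntegrable_const
      (hX.intervalIntegrable hL hL' hab) fun t _ => by
        have := hm (X t) (vel E X t)
        exact add_le_add_left this κ
  rw [intervalIntegral.integral_const, smul_eq_mul] at h1
  linarith

/-- Follow `X` until time `T`, then `Y`. -/
noncomputable def concat (X Y : ℝ → M) (T : ℝ) (t : ℝ) : M := if t ≤ T then X t else Y (t - T)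

lemma concat_eqOn_left (X Y : ℝ → M) (T : ℝ) : EqOn (concat X Y T) X (Icc 0 T) :=
  fun _ ht => if_pos ht.2

lemma concat_eqOn_right {T : ℝ} (h : X T = Y 0) (b : ℝ) :
    EqOn (concat X Y T) (fun t => Y (t - T)) (Icc T b) := fun t ht => by
  rcases ht.1.eq_or_lt with rfl | h'
  · simp [concat, h]
  · exact if_neg h'.not_ge

lemma SobolevOn.concat {T T' : ℝ} (hX : SobolevOn E X 0 T) (hY : SobolevOn E Y 0 T')
    (hT : 0 ≤ T) (hT' : 0 ≤ T') (h : X T = Y 0) :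
    SobolevOn E (concat X Y T) 0 T ∧ SobolevOn E (FreePeriod.concat X Y T) T (T + T') := by
  refine ⟨hX.congr hT (concat_eqOn_left X Y T).symm, ?_⟩
  refine SobolevOn.congr ?_ (by linarith) (concat_eqOn_right h _).symm
  have := SobolevOn.comp_affine (E := E) (X := Y) (a := T) (b := T + T') (α := 1) (β := -T)
    one_pos (by simpa using hY) (by linarith)
  simpa [sub_eq_add_neg] using this

lemma curveAction_concat (hL : Continuous L) (hL' : IsElectromagneticAtInfinity L) {T T' : ℝ}
    (hX : SobolevOn E X 0 T) (hY : SobolevOn E Y 0 T') (hT : 0 ≤ T) (hT' : 0 ≤ T')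
    (h : X T = Y 0) : curveAction L κ (concat X Y T) 0 (T + T') =
      curveAction L κ X 0 T + curveAction L κ Y 0 T' := by
  obtain ⟨h1, h2⟩ := hX.concat hY hT hT' h
  rw [← curveAction_add hL hL' h1 h2 hT (by linarith),
    curveAction_congr hT (concat_eqOn_left X Y T),
    curveAction_congr (by linarith) (concat_eqOn_right h (T + T'))]
  have := curveAction_comp_sub (L := L) (κ := κ) (X := Y) (a := 0) (b := T') T
  rw [zero_add, add_comm T' T] at this
  rw [this]

/-- The periodic curve of period `T` described by a pair `(x, T)`. -/
noncomputable def loopCurve (z : LoopPeriod E M) (t : ℝ) : M :=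
  z.1.1 (((z.2 : ℝ)⁻¹ * t : ℝ) : UnitAddCircle)

lemma sobolevOn_loopCurve (z : LoopPeriod E M) : SobolevOn E (loopCurve z) 0 (z.2 : ℝ) := by
  have hT : (0 : ℝ) < z.2 := z.2.2
  have := SobolevOn.comp_affine (E := E) (a := 0) (b := (z.2 : ℝ)) (β := 0) (inv_pos.2 hT)
    (by rw [mul_zero, add_zero, inv_mul_cancel₀ hT.ne', add_zero]; exact z.1.sobolevOn) hT.le
  simp only [add_zero] at this
  exact this

lemma curveAction_loopCurve (z : LoopPeriod E M) :
    curveAction L κ (loopCurve z) 0 (z.2 : ℝ) = action L κ z := by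
  have hT : (0 : ℝ) < z.2 := z.2.2
  have h : ∀ t, L (lift E (loopCurve z) t) + κ =
      (fun s : ℝ => L ⟨z.1.1 (s : UnitAddCircle), (z.2 : ℝ)⁻¹ • velocity E z.1.1 s⟩ + κ)
        ((z.2 : ℝ)⁻¹ * t) := fun t => by
    have := lift_comp_affine_of_eq (E := E) (fun s : ℝ => z.1.1 (s : UnitAddCircle))
      (inv_ne_zero hT.ne') (add_zero ((z.2 : ℝ)⁻¹ * t)).symm
    simp only [add_zero] at this
    exact congrArg (fun w => L w + κ) this
  rw [curveAction, intervalIntegral.integral_congr (fun t _ => h t)]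
  refine (intervalIntegral.integral_comp_mul_left (fun s : ℝ =>
    L ⟨z.1.1 (s : UnitAddCircle), (z.2 : ℝ)⁻¹ • velocity E z.1.1 s⟩ + κ)
      (inv_ne_zero hT.ne')).trans ?_
  rw [mul_zero, inv_mul_cancel₀ hT.ne', inv_inv, smul_eq_mul]
  rfl

/-- A closed curve of class `W^{1,2}` is described by a loop with a period. -/
lemma SobolevOn.exists_loopPeriod {T : ℝ} (hX : SobolevOn E X 0 T) (hT : 0 < T) (h : X 0 = X T) :
    ∃ z : LoopPeriod E M, (∀ s ∈ Icc (0 : ℝ) 1, z.1.1 (s : UnitAddCircle) = X (T * s)) ∧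
      ∀ (L : TangentBundle 𝓘(ℝ, E) M → ℝ) κ, action L κ z = curveAction L κ X 0 T := by
  have h1 : SobolevOn E (fun s => X (T * s)) 0 1 := by
    have := SobolevOn.comp_affine (E := E) (X := X) (a := 0) (b := 1) (β := 0) hT
      (by simpa using hX) zero_le_one
    simpa using this
  have h2 : (fun s => X (T * s)) 0 = (fun s => X (T * s)) 1 := by simpa using h
  refine ⟨⟨h1.loop h2, ⟨T, hT⟩⟩, fun s hs => h1.loop_apply h2 hs, fun L κ => ?_⟩
  rw [← curveAction_loopCurve]
  refine curveAction_congr hT.le fun t ht => ?_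
  rw [loopCurve, h1.loop_apply h2]
  · dsimp only
    rw [mul_inv_cancel_left₀ hT.ne']
  · exact ⟨mul_nonneg (inv_pos.2 hT).le ht.1, by
      rw [inv_mul_le_iff₀ hT, mul_one]; exact ht.2⟩

end Integrability

/-! ### Free homotopies and conjugation of path classes -/

section FreeHomotopy

variable {M : Type*} [TopologicalSpace M]

/-- The path which goes once around the circle. -/
def circlePath : Path ((0 : ℝ) : UnitAddCircle) ((0 : ℝ) : UnitAddCircle) where
  toFun s := ((s : ℝ) : UnitAddCircle)
  continuous_toFun := (AddCircle.continuous_mk' 1).comp continuous_subtype_val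
  source' := rfl
  target' := circle_coe_one

/-- The conjugating class `b` is the track of the base point under the free homotopy. -/
lemma exists_trans_eq_of_homotopic {f g : C(UnitAddCircle, M)} {p q : M} {γ : Path p p}
    {γ' : Path q q} (hf : ∀ s : unitInterval, f ((s : ℝ) : UnitAddCircle) = γ s)
    (hg : ∀ s : unitInterval, g ((s : ℝ) : UnitAddCircle) = γ' s) (h : f.Homotopic g) :
    ∃ b : Path.Homotopic.Quotient p q,
      (Path.Homotopic.Quotient.mk γ).trans b = b.trans (Path.Homotopic.Quotient.mk γ') := by
  obtain ⟨F⟩ := h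
  obtain rfl : p = f ((0 : ℝ) : UnitAddCircle) := (γ.source.symm.trans (hf 0).symm)
  obtain rfl : q = g ((0 : ℝ) : UnitAddCircle) := (γ'.source.symm.trans (hg 0).symm)
  obtain rfl : γ = circlePath.map f.continuous := Path.ext (funext fun s => (hf s).symm)
  obtain rfl : γ' = circlePath.map g.continuous := Path.ext (funext fun s => (hg s).symm)
  refine ⟨Path.Homotopic.Quotient.mk (F.evalAt _), ?_⟩
  rw [← Path.Homotopic.Quotient.mk_trans, ← Path.Homotopic.Quotient.mk_trans,
    Path.Homotopic.Quotient.eq]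
  exact Path.Homotopic.map_trans_evalAt F circlePath

lemma homotopic_of_path_homotopic {f g : C(UnitAddCircle, M)} {p : M} {γ γ' : Path p p}
    (hf : ∀ s : unitInterval, f ((s : ℝ) : UnitAddCircle) = γ s)
    (hg : ∀ s : unitInterval, g ((s : ℝ) : UnitAddCircle) = γ' s) (h : γ.Homotopic γ') :
    f.Homotopic g := by
  obtain ⟨H⟩ := h
  -- Curried in the loop variable, the homotopy is a path of paths. Its two ends agree because the
  -- base point is fixed, so it descends to the circle.
  let K : C(unitInterval, C(unitInterval, M)) :=
    (H.toContinuousMap.comp ⟨Prod.swap, continuous_swap⟩).curry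
  have hK : ∀ s r, K s r = H (r, s) := fun s r => rfl
  let X : ℝ → C(unitInterval, M) := fun s => K (projIcc 0 1 zero_le_one s)
  have hX : Continuous X := K.continuous.comp continuous_projIcc
  have hX01 : X 0 = X 1 := by
    ext r
    simp only [X, projIcc_left, projIcc_right, hK]
    exact (H.source r).trans (H.target r).symm
  let G := circleMap hX.continuousOn hX01
  have hG : ∀ (s : unitInterval) r, G ((s : ℝ) : UnitAddCircle) r = H (r, s) := fun s r => by
    change circleMap hX.continuousOn hX01 _ r = _
    rw [circleMap_apply hX.continuousOn hX01 s.2]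
    simp only [X, projIcc_val, hK]
  have key : ∀ t : UnitAddCircle, ∃ s : unitInterval, ((s : ℝ) : UnitAddCircle) = t := by
    intro t
    obtain ⟨s, hs, rfl⟩ := exists_coe_eq t
    exact ⟨⟨s, hs⟩, rfl⟩
  refine ⟨⟨(G.uncurry).comp ⟨Prod.swap, continuous_swap⟩, fun t => ?_, fun t => ?_⟩⟩
  · obtain ⟨s, rfl⟩ := key t
    exact (hG s 0).trans ((H.apply_zero s).trans (hf s).symm)
  · obtain ⟨s, rfl⟩ := key t
    exact (hG s 1).trans ((H.apply_one s).trans (hg s).symm)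

lemma nullhomotopic_iff {f : C(UnitAddCircle, M)} {p : M} {γ : Path p p}
    (hf : ∀ s : unitInterval, f ((s : ℝ) : UnitAddCircle) = γ s) :
    f.Nullhomotopic ↔ Path.Homotopic.Quotient.mk γ = Path.Homotopic.Quotient.refl p := by
  constructor
  · rintro ⟨q, hq⟩
    obtain ⟨b, hb⟩ := exists_trans_eq_of_homotopic hf (γ' := Path.refl q) (fun _ => rfl) hq
    rw [Path.Homotopic.Quotient.mk_refl, Path.Homotopic.Quotient.trans_refl] at hb
    have := congrArg (fun c => c.trans b.symm) hb
    simpa [Path.Homotopic.Quotient.trans_assoc] using this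
  · intro h
    rw [← Path.Homotopic.Quotient.mk_refl, Path.Homotopic.Quotient.eq] at h
    exact ⟨p, homotopic_of_path_homotopic hf (fun _ => rfl) h⟩

end FreeHomotopy

/-! ### Actions realised in a path homotopy class -/

section HomotopyClasses

variable {E : Type*} [NormedAddCommGroup E] [NormedSpace ℝ E] [FiniteDimensional ℝ E]
  {M : Type*} [MetricSpace M] [CompactSpace M] [ChartedSpace E M] [IsManifold 𝓘(ℝ, E) ∞ M]
  [RiemannianBundle (fun x : M => TangentSpace 𝓘(ℝ, E) x)]
  [IsContMDiffRiemannianBundle 𝓘(ℝ, E) ∞ E (fun x : M => TangentSpace 𝓘(ℝ, E) x)]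
  [IsRiemannianManifold 𝓘(ℝ, E) M]
  {L : TangentBundle 𝓘(ℝ, E) M → ℝ} {κ : ℝ} {p q r : M}

/-- `A` is the action of a `W^{1,2}` curve in the homotopy class `g`. -/
def IsActionOf (L : TangentBundle 𝓘(ℝ, E) M → ℝ) (κ : ℝ) (g : Path.Homotopic.Quotient p q)
    (A : ℝ) : Prop :=
  ∃ (T : ℝ) (X : ℝ → M) (γ : Path p q), 0 < T ∧ SobolevOn E X 0 T ∧
    (∀ s : unitInterval, γ s = X (T * s)) ∧ Path.Homotopic.Quotient.mk γ = g ∧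
    curveAction L κ X 0 T = A

-- A close Sobolev approximation with the same endpoints is homotopic to the given path relative to
-- the endpoints.
variable (L κ) in
lemma exists_isActionOf (g : Path.Homotopic.Quotient p q) : ∃ A, IsActionOf L κ g A := by
  induction g using Path.Homotopic.Quotient.ind with | mk γ =>
  obtain ⟨ε, hε, hh⟩ := exists_pos_homotopicRel E M unitInterval
  obtain ⟨X, hX, h0, h1, hd⟩ := exists_sobolevOn_near E γ.continuous_extend zero_le_one hε
  rw [Path.extend_zero] at h0
  rw [Path.extend_one] at h1
  let γ' : Path p q :=
    { toFun := fun s => X s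
      continuous_toFun := (hX.continuousOn zero_le_one).domRestrict
      source' := h0
      target' := h1 }
  refine ⟨_, 1, X, γ', one_pos, hX, fun s => by rw [one_mul]; rfl, ?_, rfl⟩
  rw [Path.Homotopic.Quotient.eq]
  refine homotopicRel_mono (hh γ'.toContinuousMap γ.toContinuousMap fun s => ?_) ?_
  · have := hd s s.2
    rwa [γ.extend_apply s.2] at this
  · rintro s (rfl | rfl)
    · exact γ'.source.trans γ.source.symm
    · exact γ'.target.trans γ.target.symm

lemma IsActionOf.trans (hL : Continuous L) (hL' : IsElectromagneticAtInfinity L)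
    {g : Path.Homotopic.Quotient p q} {g' : Path.Homotopic.Quotient q r} {A A' : ℝ}
    (h : IsActionOf L κ g A) (h' : IsActionOf L κ g' A') :
    IsActionOf L κ (g.trans g') (A + A') := by
  obtain ⟨T, X, γ, hT, hX, hγ, rfl, rfl⟩ := h
  obtain ⟨T', Y, γ', hT', hY, hγ', rfl, rfl⟩ := h'
  have hXY : X T = Y 0 := by
    have h1 := hγ 1
    have h2 := hγ' 0
    simp only [Path.target, Path.source, Set.Icc.coe_one, Set.Icc.coe_zero, mul_one,
      mul_zero] at h1 h2
    rw [← h1, h2]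
  obtain ⟨hZ, hZ'⟩ := hX.concat hY hT.le hT'.le hXY
  have hZZ := hZ.trans hZ' hT.le (by linarith)
  have hTT : 0 < T + T' := by linarith
  have hl := concat_eqOn_left X Y T
  have hr := concat_eqOn_right hXY (T + T')
  have hmem : ∀ s : unitInterval, (T + T') * (s : ℝ) ∈ Icc 0 (T + T') := fun s =>
    ⟨mul_nonneg hTT.le s.2.1, mul_le_of_le_one_right hTT.le s.2.2⟩
  let δ : Path p r :=
    { toFun := fun s => concat X Y T ((T + T') * s)
      continuous_toFun := (hZZ.continuousOn hTT.le).comp_continuous (by fun_prop) hmem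
      source' := by
        have := hγ 0
        simp only [Path.source, Set.Icc.coe_zero, mul_zero] at this ⊢
        rw [hl ⟨le_rfl, hT.le⟩, this]
      target' := by
        have := hγ' 1
        simp only [Path.target, Set.Icc.coe_one, mul_one] at this ⊢
        rw [hr ⟨by linarith, le_rfl⟩, this]
        simp }
  -- `Path.trans` gives each half the time `1/2`, the concatenated curve the times `T` and `T'`. The
  -- map `f` is the piecewise linear change of time between the two.
  have hfmem : ∀ s : unitInterval,
      (T * min (2 * (s : ℝ)) 1 + T' * max (2 * (s : ℝ) - 1) 0) / (T + T')
      ∈ unitInterval := fun s => by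
    have h0 := s.2.1
    have h1 := s.2.2
    have h2 : 0 ≤ min (2 * (s : ℝ)) 1 := le_min (by linarith) zero_le_one
    have h3 : min (2 * (s : ℝ)) 1 ≤ 1 := min_le_right _ _
    have h4 : 0 ≤ max (2 * (s : ℝ) - 1) 0 := le_max_right _ _
    have h5 : max (2 * (s : ℝ) - 1) 0 ≤ 1 := max_le (by linarith) zero_le_one
    refine ⟨by positivity, ?_⟩
    rw [div_le_one hTT]
    nlinarith
  let f : unitInterval → unitInterval := fun s => ⟨_, hfmem s⟩
  have hf : Continuous f := by
    refine Continuous.subtype_mk ?_ _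
    fun_prop
  have hf0 : f 0 = 0 := by
    ext
    simp [f]
  have hf1 : f 1 = 1 := by
    ext
    have : (2 : ℝ) - 1 = 1 := by norm_num
    simp [f, this, hTT.ne']
  have hδ : γ.trans γ' = δ.reparam f hf hf0 hf1 := by
    ext s
    have hfs : (T + T') * (f s : ℝ) = T * min (2 * (s : ℝ)) 1 + T' * max (2 * (s : ℝ) - 1) 0 := by
      simp only [f]
      field_simp
    have hδs : δ.reparam f hf hf0 hf1 s = concat X Y T ((T + T') * f s) := rfl
    rw [hδs, hfs, Path.trans_apply]
    split_ifs with h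
    · have e1 : min (2 * (s : ℝ)) 1 = 2 * s := min_eq_left (by linarith)
      have e2 : max (2 * (s : ℝ) - 1) 0 = 0 := max_eq_right (by linarith)
      rw [e1, e2, mul_zero, add_zero, hγ, hl]
      exact ⟨mul_nonneg hT.le (by linarith [s.2.1]), mul_le_of_le_one_right hT.le (by linarith)⟩
    · have e1 : min (2 * (s : ℝ)) 1 = 1 := min_eq_right (by linarith)
      have e2 : max (2 * (s : ℝ) - 1) 0 = 2 * s - 1 := max_eq_left (by linarith)
      rw [e1, e2, mul_one, hγ', hr]
      · simp
      · have := s.2.2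
        constructor
        · nlinarith
        · nlinarith
  refine ⟨T + T', concat X Y T, δ, hTT, hZZ, fun s => rfl, ?_,
    curveAction_concat hL hL' hX hY hT.le hT'.le hXY⟩
  rw [← Path.Homotopic.Quotient.mk_trans, hδ, Path.Homotopic.Quotient.eq]
  exact ⟨Path.Homotopy.reparam δ f hf hf0 hf1⟩

variable (L κ) in
lemma exists_isActionOf_loop (z : LoopPeriod E M) :
    ∃ γ : Path (z.1.1 ((0 : ℝ) : UnitAddCircle)) (z.1.1 ((0 : ℝ) : UnitAddCircle)),
      (∀ s : unitInterval, z.1.1 ((s : ℝ) : UnitAddCircle) = γ s) ∧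
      IsActionOf L κ (Path.Homotopic.Quotient.mk γ) (action L κ z) := by
  have hT : (0 : ℝ) < z.2 := z.2.2
  refine ⟨circlePath.map z.1.1.continuous, fun s => rfl, z.2, loopCurve z, _, hT,
    sobolevOn_loopCurve z, fun s => ?_, rfl, curveAction_loopCurve z⟩
  rw [loopCurve, inv_mul_cancel_left₀ hT.ne']
  rfl

lemma IsActionOf.exists_loop {g : Path.Homotopic.Quotient p p} {A : ℝ} (h : IsActionOf L κ g A) :
    ∃ (z : LoopPeriod E M) (γ : Path p p),
      (∀ s : unitInterval, z.1.1 ((s : ℝ) : UnitAddCircle) = γ s) ∧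
      Path.Homotopic.Quotient.mk γ = g ∧ action L κ z = A := by
  obtain ⟨T, X, γ, hT, hX, hγ, hg, rfl⟩ := h
  have h01 : X 0 = X T := by
    have h1 := hγ 1
    have h2 := hγ 0
    simp only [Path.target, Path.source, Set.Icc.coe_one, Set.Icc.coe_zero, mul_one,
      mul_zero] at h1 h2
    rw [← h1, ← h2]
  obtain ⟨z, hz, hA⟩ := hX.exists_loopPeriod hT h01
  exact ⟨z, γ, fun s => (hz s s.2).trans (hγ s).symm, hg, hA L κ⟩

end HomotopyClasses

/-! ### The two sides of the Mañé critical value -/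

section ManeValue

variable {E : Type*} [NormedAddCommGroup E] [NormedSpace ℝ E] [FiniteDimensional ℝ E]
  {M : Type*} [MetricSpace M] [CompactSpace M] [ChartedSpace E M] [IsManifold 𝓘(ℝ, E) ∞ M]
  [RiemannianBundle (fun x : M => TangentSpace 𝓘(ℝ, E) x)]
  [IsContMDiffRiemannianBundle 𝓘(ℝ, E) ∞ E (fun x : M => TangentSpace 𝓘(ℝ, E) x)]
  [IsRiemannianManifold 𝓘(ℝ, E) M]
  {L : TangentBundle 𝓘(ℝ, E) M → ℝ} {κ : ℝ}

lemma action_eq_add (hL : Continuous L) (hL' : IsElectromagneticAtInfinity L) (κ : ℝ)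
    (z : LoopPeriod E M) : action L κ z = action L 0 z + κ * z.2 := by
  rw [← curveAction_loopCurve, ← curveAction_loopCurve,
    curveAction_eq_add hL hL' (sobolevOn_loopCurve z) z.2.2.le, sub_zero]

/-- The action is affine in `κ` with slope the period, so nonnegativity passes to the infimum.
Admissible values exist because `L ≥ -K`. -/
lemma action_nonneg_of_lowestManeValue_le (hL : Continuous L)
    (hL' : IsElectromagneticAtInfinity L) (hκ : lowestManeValue L ≤ κ) (z : LoopPeriod E M)
    (hz : z.1.1.Nullhomotopic) : 0 ≤ action L κ z := by
  have hT : (0 : ℝ) < z.2 := z.2.2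
  obtain ⟨K, hK, hb⟩ := exists_bounds hL hL'
  have hne : {κ : ℝ | ∀ z : LoopPeriod E M, z.1.1.Nullhomotopic → 0 ≤ action L κ z}.Nonempty := by
    refine ⟨K, fun w _ => ?_⟩
    have := le_curveAction (κ := K) hL hL' (fun y v => (hb y v).2) (sobolevOn_loopCurve w)
      w.2.2.le
    rwa [curveAction_loopCurve, neg_add_cancel, zero_mul] at this
  refine le_of_forall_pos_le_add fun ε hε => ?_
  have h1 : lowestManeValue L < κ + ε / z.2 := by
    have : 0 < ε / z.2 := by positivity
    linarith
  obtain ⟨κ', h2, h3⟩ := exists_lt_of_csInf_lt hne h1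
  have h4 := h2 z hz
  rw [action_eq_add hL hL'] at h4 ⊢
  have h5 : κ' * z.2 ≤ (κ + ε / z.2) * z.2 := by gcongr
  rw [add_mul, div_mul_cancel₀ _ hT.ne'] at h5
  linarith

/-- The infimum is meaningful only if the admissible set is bounded below; a single contractible
loop of action `A` at `κ = 0` and period `T` gives the bound `-A / T`. -/
lemma exists_action_neg_of_lt_lowestManeValue [Nonempty M] (hL : Continuous L)
    (hL' : IsElectromagneticAtInfinity L) (hκ : κ < lowestManeValue L) :
    ∃ z : LoopPeriod E M, z.1.1.Nullhomotopic ∧ action L κ z < 0 := by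
  by_contra! h
  refine hκ.not_ge (csInf_le ?_ h)
  obtain ⟨p⟩ := ‹Nonempty M›
  obtain ⟨A, hA⟩ := exists_isActionOf L 0 (Path.Homotopic.Quotient.refl p)
  obtain ⟨z, γ, hγ, hg, hz⟩ := hA.exists_loop
  have hT : (0 : ℝ) < z.2 := z.2.2
  refine ⟨-A / z.2, fun κ' hκ' => ?_⟩
  have h1 := hκ' z ((nullhomotopic_iff hγ).2 hg)
  rw [action_eq_add hL hL', hz] at h1
  rw [div_le_iff₀ hT]
  linarith

lemma bddBelow_action_image (hL : Continuous L) (hL' : IsElectromagneticAtInfinity L)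
    (hκ : lowestManeValue L ≤ κ) (z : LoopPeriod E M) :
    BddBelow (action L κ '' connectedComponent z) := by
  obtain ⟨γ, hγ, -⟩ := exists_isActionOf_loop L κ z
  obtain ⟨c, hc⟩ := exists_isActionOf L κ (Path.Homotopic.Quotient.mk γ).symm
  -- The constant `c` is chosen from `z` alone, before the loop `w` in its component.
  refine ⟨-c, ?_⟩
  rintro _ ⟨w, hw, rfl⟩
  rw [connectedComponent_prod] at hw
  obtain ⟨δ, hδ, hw'⟩ := exists_isActionOf_loop L κ w
  obtain ⟨b, hb⟩ := exists_trans_eq_of_homotopic hδ hγ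
    (homotopic_of_mem_connectedComponent hw.1).symm
  obtain ⟨A, hA⟩ := exists_isActionOf L κ b
  obtain ⟨A', hA'⟩ := exists_isActionOf L κ b.symm
  -- Each step replaces `b` by `δ b γ⁻¹`, which is the same class.
  have hiter : ∀ N : ℕ, IsActionOf L κ b (A + N * (action L κ w + c)) := by
    intro N
    induction N with
    | zero => simpa using hA
    | succ N ih =>
      have h1 := (hw'.trans hL hL' ih).trans hL hL' hc
      rw [hb, Path.Homotopic.Quotient.trans_assoc, Path.Homotopic.Quotient.trans_symm,
        Path.Homotopic.Quotient.trans_refl] at h1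
      convert h1 using 1
      push_cast
      ring
  by_contra! hneg
  obtain ⟨N, hN⟩ := exists_nat_gt ((A + A') / (-(action L κ w + c)))
  rw [div_lt_iff₀ (by linarith)] at hN
  -- Closing up with `b⁻¹` gives a contractible loop, whose action is negative for this `N`.
  have h1 := (hiter N).trans hL hL' hA'
  rw [Path.Homotopic.Quotient.trans_symm] at h1
  obtain ⟨y, η, hη, hg, hy⟩ := h1.exists_loop
  have h2 := action_nonneg_of_lowestManeValue_le hL hL' hκ y ((nullhomotopic_iff hη).2 hg)
  linarith

lemma not_bddBelow_action_image [ConnectedSpace M] (hL : Continuous L)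
    (hL' : IsElectromagneticAtInfinity L) (hκ : κ < lowestManeValue L) (z : LoopPeriod E M) :
    ¬ BddBelow (action L κ '' connectedComponent z) := by
  rintro ⟨m, hm⟩
  obtain ⟨w, hw, hneg⟩ := exists_action_neg_of_lt_lowestManeValue hL hL' hκ
  obtain ⟨γ, hγ, -⟩ := exists_isActionOf_loop L κ z
  obtain ⟨δ, hδ, hw'⟩ := exists_isActionOf_loop L κ w
  rw [(nullhomotopic_iff hδ).1 hw] at hw'
  have : LocallyPathConnectedSpace M := ChartedSpace.locallyPathConnectedSpace E M
  have : PathConnectedSpace M := pathConnectedSpace_iff_connectedSpace.2 inferInstance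
  let b := Path.Homotopic.Quotient.mk (PathConnectedSpace.somePath
    (w.1.1 ((0 : ℝ) : UnitAddCircle)) (z.1.1 ((0 : ℝ) : UnitAddCircle)))
  obtain ⟨A, hA⟩ := exists_isActionOf L κ b
  -- The remaining part of the loop is `γ b⁻¹`, so that inserting repetitions of `w` before `b`
  -- restores the class of `γ`.
  obtain ⟨A', hA'⟩ := exists_isActionOf L κ ((Path.Homotopic.Quotient.mk γ).trans b.symm)
  have hiter : ∀ N : ℕ, IsActionOf L κ b (A + N * action L κ w) := by
    intro N
    induction N with
    | zero => simpa using hA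
    | succ N ih =>
      have h1 := hw'.trans hL hL' ih
      rw [Path.Homotopic.Quotient.refl_trans] at h1
      convert h1 using 1
      push_cast
      ring
  obtain ⟨N, hN⟩ := exists_nat_gt ((A' + A - m) / (-action L κ w))
  rw [div_lt_iff₀ (by linarith)] at hN
  have h1 := hA'.trans hL hL' (hiter N)
  rw [Path.Homotopic.Quotient.trans_assoc, Path.Homotopic.Quotient.symm_trans,
    Path.Homotopic.Quotient.trans_refl] at h1
  obtain ⟨y, η, hη, hg, hy⟩ := h1.exists_loop
  rw [Path.Homotopic.Quotient.eq] at hg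
  -- Only the loop factor matters for the component, since the space of periods `(0, ∞)` is
  -- connected.
  have hj : Joined z.1 y.1 := joined_of_homotopic (homotopic_of_path_homotopic hη hγ hg).symm
  have hyz : y ∈ connectedComponent z := by
    rw [connectedComponent_prod]
    refine ⟨pathComponent_subset_component _ hj, ?_⟩
    have : ConnectedSpace (Ioi (0 : ℝ)) := Subtype.connectedSpace isConnected_Ioi
    rw [PreconnectedSpace.connectedComponent_eq_univ]
    exact mem_univ _
  have h2 := hm (mem_image_of_mem _ hyz)
  rw [hy] at h2
  linarith

end ManeValue

end FreePeriod


theorem lemma4p1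
    {E : Type*} [NormedAddCommGroup E] [NormedSpace ℝ E] [FiniteDimensional ℝ E]
    {M : Type*} [MetricSpace M] [CompactSpace M] [ConnectedSpace M]
    [ChartedSpace E M] [IsManifold 𝓘(ℝ, E) ∞ M]
    [RiemannianBundle (fun x : M => TangentSpace 𝓘(ℝ, E) x)]
    [IsContMDiffRiemannianBundle 𝓘(ℝ, E) ∞ E (fun x : M => TangentSpace 𝓘(ℝ, E) x)]
    [IsRiemannianManifold 𝓘(ℝ, E) M]
    (L : TangentBundle 𝓘(ℝ, E) M → ℝ)
    (hL : FreePeriod.IsTonelli L) (hL' : FreePeriod.IsElectromagneticAtInfinity L)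
    (κ : ℝ) :
    (FreePeriod.lowestManeValue L ≤ κ →
      ∀ z : FreePeriod.LoopPeriod E M,
        BddBelow (FreePeriod.action L κ '' connectedComponent z)) ∧
    (κ < FreePeriod.lowestManeValue L →
      ∀ z : FreePeriod.LoopPeriod E M,
        ¬ BddBelow (FreePeriod.action L κ '' connectedComponent z)) :=
  ⟨fun hκ z => FreePeriod.bddBelow_action_image hL.smooth.continuous hL' hκ z,
    fun hκ z => FreePeriod.not_bddBelow_action_image hL.smooth.continuous hL' hκ z⟩
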